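/- Let $n,N$ be integers with $2<n<N-1$, and let $\mathcal A$ be a collection of $N$ real numbers (repetitions allowed), not all equal. Put $$\bar a=\frac1N\sum_{a\in\mathcal A}a,\qquad \mu=n\bar a,\qquad \sigma^2=\frac{n(N-n)}{N(N-1)}\sum_{a\in\mathcal A}(a-\bar a)^2,\qquad a_3=\sum_{a\in\mathcal A}|a-\bar a|^3,$$ with $\sigma>0$ and with sums over $\mathcal A$ taken with multiplicity. Let $\{X_1,\dots,X_n\}$ be a simple random sample of size $n$ from $\mathcal A$: after labelling the $N$ members of $\mathcal A$, the unordered collection of $X_1,\dots,X_n$ is distributed as the collection of values of a uniformly chosen set of $n$ labels, each such set having probability $\binom Nn^{-1}$. Then $Y=\sum_{i=1}^n X_i$ has mean $\mu$ and variance $\sigma^2$, and the distribution function $F$ of the standardized variable $W=(Y-\mu)/\sigma$ satisfies $$\|F-\Phi\|_1=\int_{-\infty}^{\infty}|F(t)-\Phi(t)|\,dt\le\frac{4a_3}{\sigma^3}\left(\frac{n(N-n)}{N(N-1)}\right)\left(1+\frac nN\right)^2,$$ where $\Phi$ is the distribution function of the standard normal distribution. -/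

import Mathlib

open MeasureTheory ProbabilityTheory

namespace SimpleRandomSampling

noncomputable section

/-- The average `ā` of a population of `N` real numbers. The population is labelled by `Fin N`,
so that repeated values are allowed. -/
def popMean {N : ℕ} (a : Fin N → ℝ) : ℝ :=
  (∑ j, a j) / N

/-- The third-moment-type quantity `a₃ = ∑ |a - ā|³`. -/
def popThird {N : ℕ} (a : Fin N → ℝ) : ℝ :=
  ∑ j, |a j - popMean a| ^ 3

/-- `μ = n ā`. -/
def sumMean {N : ℕ} (n : ℕ) (a : Fin N → ℝ) : ℝ :=
  n * popMean a

/-- `σ² = n (N - n) / (N (N - 1)) ∑ (a - ā)²`. -/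
def sumVariance {N : ℕ} (n : ℕ) (a : Fin N → ℝ) : ℝ :=
  (n * ((N : ℝ) - n)) / (N * ((N : ℝ) - 1)) * ∑ j, (a j - popMean a) ^ 2

/-- The nonnegative square root `σ` of `σ²`. -/
def sumStdDev {N : ℕ} (n : ℕ) (a : Fin N → ℝ) : ℝ :=
  √(sumVariance n a)

/-- `X₁, …, Xₙ` is a simple random sample of size `n` from the population `a`: the unordered
collection of the `Xᵢ` (with multiplicities) is distributed as the collection of the values of the
members of a random set of `n` labels, each of the `N.choose n` such sets being equally likely.
The order in which the sample is listed is not restricted. -/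
structure IsSimpleRandomSample {Ω : Type*} [MeasurableSpace Ω] (P : Measure Ω) {n N : ℕ}
    (a : Fin N → ℝ) (X : Fin n → Ω → ℝ) : Prop where
  measurable : ∀ i, Measurable (X i)
  law : ∀ M : Multiset ℝ,
    P.real {ω | (Finset.univ : Finset (Fin n)).val.map (fun i => X i ω) = M} =
      (Nat.card {s : Finset (Fin N) // s.card = n ∧ s.val.map a = M} : ℝ) / (N.choose n : ℝ)

/-- The standardized sum `W = (Y - μ) / σ`, where `Y = X₁ + ⋯ + Xₙ`. -/
def standardizedSum {Ω : Type*} {n N : ℕ} (a : Fin N → ℝ) (X : Fin n → Ω → ℝ) (ω : Ω) : ℝ :=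
  ((∑ i, X i ω) - sumMean n a) / sumStdDev n a

end

end SimpleRandomSampling

/-!
Stein's method with the zero-bias transformation. For each `t` let `f_t` be the bounded solution of
`f'(x) - x f(x) = 1(x ≤ t) - Φ(t)`. If `W` has mean zero and variance one and `W*` satisfies
`E[W f(W)] = E[f'(W*)]`, then `F(t) - Φ(t) = E[f_t'(W) - f_t'(W*)]`, so everything rests on

* an analytic estimate, `∫ |f_t'(x) - f_t'(y)| dt ≤ 2 |x - y|`
  (`lintegral_enorm_steinDeriv_sub_le`), which gives `∫ |F - Φ| ≤ 2 E|W - W*|`. The integral over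
  `t` is computed in closed form from `A(x) = 1 + x Φ(x) / φ(x)` and `J(x) = x Φ(x) + φ(x)`, the
  primitive of `Φ`; its derivative in `y` is at most `2` because of the Mills ratio inequality and
  the identities `A(y) Φ(-y) + A(-y) Φ(y) = 1` and `A'(y) J(-y) + A'(-y) J(y) = 1`;
* a coupling of the sample sum with its zero-biased version. Let `c` be the centred and scaled
  population. Exchanging a sampled and an unsampled label turns `E[W f(W)]` into an average of
  `(c i - c j) (f(w(R) + c i) - f(w(R) + c j))` over labels `i`, `j` and sets `R` of `n - 1` other
  labels, `w(R)` being the sum of `c` over `R` (`sum_samples_mul_eq`). Hence `W*` is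
  `w(R) + U c i + (1 - U) c j` with `U` uniform on `[0, 1]`, the pair `(i, j)` being chosen with
  probability proportional to `(c i - c j)²`. Given `i` and `j`, an ordinary sample is obtained from
  `R` by adding `i` or `j`, by adding a further label, or by removing a label and adding both `i`
  and `j` (`sum_samples_eq`), so that `W` and `W*` differ in at most a few terms.

Summing the resulting bounds over `i`, `j` and the changed label `k` leads to the third moments
`∑ (c i - c j)² |c i - c j|` and `∑ (c i - c j)² |c k - c i|`, which are at most `4 N ∑ |c i|³`
and `4 N² ∑ |c i|³` because the terms linear in a centred variable drop out.

All averages over samples are finite sums; an expectation of a symmetric statistic of `X₁, …, Xₙ` is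
rewritten as such a sum by `IsSimpleRandomSample.integral_eq`.
-/

namespace SimpleRandomSampling

open Set Filter Topology

noncomputable section

/-! ### The standard normal distribution -/

/-- The standard normal density `φ`. -/
def stdPdf (x : ℝ) : ℝ := gaussianPDFReal 0 1 x

/-- The standard normal distribution function `Φ`. -/
def stdCdf (x : ℝ) : ℝ := cdf (gaussianReal 0 1) x

lemma stdPdf_eq (x : ℝ) : stdPdf x = (√(2 * Real.pi))⁻¹ * Real.exp (-x ^ 2 / 2) := by
  simp [stdPdf, gaussianPDFReal]

lemma stdPdf_pos (x : ℝ) : 0 < stdPdf x := gaussianPDFReal_pos 0 1 x one_ne_zero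

lemma hasDerivAt_stdPdf (x : ℝ) : HasDerivAt stdPdf (-x * stdPdf x) x := by
  have h : HasDerivAt (fun x : ℝ => (√(2 * Real.pi))⁻¹ * Real.exp (-x ^ 2 / 2))
      ((√(2 * Real.pi))⁻¹ * (Real.exp (-x ^ 2 / 2) * (-(2 * x) / 2))) x := by
    have := ((((hasDerivAt_id x).pow 2).neg.div_const 2).exp).const_mul ((√(2 * Real.pi))⁻¹)
    simpa using this
  have e : stdPdf = fun x : ℝ => (√(2 * Real.pi))⁻¹ * Real.exp (-x ^ 2 / 2) := funext stdPdf_eq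
  rw [stdPdf_eq, e]
  convert h using 1
  ring

lemma continuous_stdPdf : Continuous stdPdf :=
  continuous_iff_continuousAt.2 fun x => (hasDerivAt_stdPdf x).continuousAt

lemma stdPdf_neg (x : ℝ) : stdPdf (-x) = stdPdf x := by simp [stdPdf_eq]

lemma tendsto_stdPdf_atTop : Tendsto stdPdf atTop (𝓝 0) := by
  have e : stdPdf = fun x : ℝ => (√(2 * Real.pi))⁻¹ * Real.exp (-x ^ 2 / 2) := funext stdPdf_eq
  rw [e, ← mul_zero ((√(2 * Real.pi))⁻¹)]
  refine (Real.tendsto_exp_atBot.comp ?_).const_mul _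
  have h : Tendsto (fun x : ℝ => x ^ 2 / 2) atTop atTop :=
    (tendsto_pow_atTop two_ne_zero).atTop_div_const two_pos
  refine (tendsto_neg_atTop_atBot.comp h).congr fun x => ?_
  simp only [Function.comp]
  ring

lemma tendsto_stdPdf_atBot : Tendsto stdPdf atBot (𝓝 0) :=
  (tendsto_stdPdf_atTop.comp tendsto_neg_atBot_atTop).congr fun x => stdPdf_neg x

lemma stdCdf_eq_integral (x : ℝ) : stdCdf x = ∫ s in Iic x, stdPdf s := by
  rw [stdCdf, cdf_eq_real, measureReal_def, gaussianReal_apply_eq_integral 0 one_ne_zero,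
    ENNReal.toReal_ofReal]
  · rfl
  · exact integral_nonneg fun s => (stdPdf_pos s).le

lemma hasDerivAt_stdCdf (x : ℝ) : HasDerivAt stdCdf (stdPdf x) x := by
  have hi : Integrable stdPdf := integrable_gaussianPDFReal 0 1
  have e : stdCdf = fun y => (∫ s in Iic (0 : ℝ), stdPdf s) + ∫ s in (0 : ℝ)..y, stdPdf s := by
    funext y
    rw [stdCdf_eq_integral,
      ← intervalIntegral.integral_Iic_sub_Iic hi.integrableOn hi.integrableOn]
    ring
  rw [e]
  exact (continuous_stdPdf.integral_hasStrictDerivAt 0 x).hasDerivAt.const_add _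

lemma continuous_stdCdf : Continuous stdCdf :=
  continuous_iff_continuousAt.2 fun x => (hasDerivAt_stdCdf x).continuousAt

lemma tendsto_stdCdf_atBot : Tendsto stdCdf atBot (𝓝 0) := tendsto_cdf_atBot _

lemma tendsto_stdCdf_atTop : Tendsto stdCdf atTop (𝓝 1) := tendsto_cdf_atTop _

lemma stdCdf_nonneg (x : ℝ) : 0 ≤ stdCdf x := cdf_nonneg _ x

lemma stdCdf_neg (x : ℝ) : stdCdf (-x) = 1 - stdCdf x := by
  have hd : ∀ y, HasDerivAt (fun y => stdCdf (-y) + stdCdf y) 0 y := fun y => by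
    have h := ((hasDerivAt_stdCdf (-y)).comp y (hasDerivAt_neg y)).add (hasDerivAt_stdCdf y)
    rw [stdPdf_neg] at h
    exact h.congr_deriv (by ring)
  have hc : ∀ y, stdCdf (-y) + stdCdf y = stdCdf (-x) + stdCdf x := fun y =>
    is_const_of_deriv_eq_zero (fun z => (hd z).differentiableAt) (fun z => (hd z).deriv) y x
  have hlim : Tendsto (fun y => stdCdf (-y) + stdCdf y) atTop (𝓝 (0 + 1)) :=
    (tendsto_stdCdf_atBot.comp tendsto_neg_atTop_atBot).add tendsto_stdCdf_atTop
  have := tendsto_nhds_unique (hlim.congr hc) tendsto_const_nhds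
  linarith

/-- A differentiable function with nonnegative derivative which tends to `0` at `-∞` is
nonnegative. -/
lemma nonneg_of_hasDerivAt_of_tendsto_atBot {g g' : ℝ → ℝ} (hg : ∀ x, HasDerivAt g (g' x) x)
    (hg' : ∀ x, 0 ≤ g' x) (hlim : Tendsto g atBot (𝓝 0)) (x : ℝ) : 0 ≤ g x := by
  have hm : Monotone g := monotone_of_deriv_nonneg (fun y => (hg y).differentiableAt)
    fun y => by rw [(hg y).deriv]; exact hg' y
  exact le_of_tendsto hlim ((eventually_le_atBot x).mono fun y hy => hm hy)

/-- The Mills ratio inequality `-zφ(z) / (1 + z²) ≤ Φ(z)`. -/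
lemma mills_lower (z : ℝ) : 0 ≤ (1 + z ^ 2) * stdCdf z + z * stdPdf z := by
  have hpos : ∀ x : ℝ, 0 < 1 + x ^ 2 := fun x => by positivity
  -- After division by `1 + z²` the derivative is `2 φ(z) / (1 + z²)²`.
  have h : 0 ≤ stdCdf z + z * stdPdf z / (1 + z ^ 2) := by
    refine nonneg_of_hasDerivAt_of_tendsto_atBot
      (g := fun z => stdCdf z + z * stdPdf z / (1 + z ^ 2))
      (g' := fun x => 2 * stdPdf x / (1 + x ^ 2) ^ 2) (fun x => ?_) (fun x => ?_) ?_ z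
    · have h1 := ((hasDerivAt_id x).mul (hasDerivAt_stdPdf x)).div
        (((hasDerivAt_id x).pow 2).const_add 1) (hpos x).ne'
      refine ((hasDerivAt_stdCdf x).add h1).congr_deriv ?_
      have := (hpos x).ne'
      simp only [id, Pi.mul_apply, Pi.pow_apply]
      field_simp
      push_cast
      ring
    · have := stdPdf_pos x
      positivity
    · rw [← add_zero (0 : ℝ)]
      refine tendsto_stdCdf_atBot.add ?_
      refine squeeze_zero_norm (fun x => ?_) tendsto_stdPdf_atBot
      rw [Real.norm_eq_abs, abs_div, abs_mul, abs_of_pos (hpos x), abs_of_pos (stdPdf_pos x),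
        div_le_iff₀ (hpos x), mul_comm]
      refine mul_le_mul_of_nonneg_left ?_ (stdPdf_pos x).le
      rw [abs_le]
      constructor <;> nlinarith [sq_nonneg (x - 1), sq_nonneg (x + 1)]
  have := mul_nonneg (hpos z).le h
  have e : (1 + z ^ 2) * (stdCdf z + z * stdPdf z / (1 + z ^ 2))
      = (1 + z ^ 2) * stdCdf z + z * stdPdf z := by
    have := (hpos z).ne'
    field_simp
  linarith

/-- `-z Φ(z) ≤ φ(z)`. -/
lemma mills_upper (z : ℝ) : 0 ≤ z * stdCdf z + stdPdf z := by
  rcases le_total 0 z with hz | hz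
  · have := stdPdf_pos z
    have := stdCdf_nonneg z
    positivity
  have hi : Integrable stdPdf := integrable_gaussianPDFReal 0 1
  have hd : ∀ s ∈ Iic z, HasDerivAt stdPdf (-s * stdPdf s) s := fun s _ => hasDerivAt_stdPdf s
  have hint : IntegrableOn (fun s => -s * stdPdf s) (Iic z) := by
    have := integrable_mul_exp_neg_mul_sq (b := 1 / 2) (by norm_num)
    refine ((this.const_mul (-(√(2 * Real.pi))⁻¹)).congr (ae_of_all _ fun s => ?_)).integrableOn
    simp only [stdPdf_eq]
    rw [show -s ^ 2 / 2 = -(1 / 2) * s ^ 2 by ring]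
    ring
  have h1 : ∫ s in Iic z, -s * stdPdf s = stdPdf z := by
    rw [integral_Iic_of_hasDerivAt_of_tendsto' hd hint tendsto_stdPdf_atBot, sub_zero]
  have h2 : ∫ s in Iic z, -z * stdPdf s ≤ ∫ s in Iic z, -s * stdPdf s := by
    refine setIntegral_mono_on (hi.const_mul _).integrableOn hint measurableSet_Iic fun s hs => ?_
    exact mul_le_mul_of_nonneg_right (neg_le_neg hs) (stdPdf_pos s).le
  rw [integral_const_mul, ← stdCdf_eq_integral, h1] at h2
  linarith

/-- `J(z) = zΦ(z) + φ(z) = ∫_{-∞}^z Φ`. -/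
def cdfPrimitive (z : ℝ) : ℝ := z * stdCdf z + stdPdf z

lemma hasDerivAt_cdfPrimitive (z : ℝ) : HasDerivAt cdfPrimitive (stdCdf z) z := by
  have h := ((hasDerivAt_id z).mul (hasDerivAt_stdCdf z)).add (hasDerivAt_stdPdf z)
  refine h.congr_deriv ?_
  simp only [id]
  ring

lemma cdfPrimitive_nonneg (z : ℝ) : 0 ≤ cdfPrimitive z := mills_upper z

lemma tendsto_cdfPrimitive_atBot : Tendsto cdfPrimitive atBot (𝓝 0) := by
  refine squeeze_zero' (Eventually.of_forall cdfPrimitive_nonneg) ?_ tendsto_stdPdf_atBot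
  filter_upwards [eventually_le_atBot 0] with z hz
  have := mul_nonpos_of_nonpos_of_nonneg hz (stdCdf_nonneg z)
  simp only [cdfPrimitive]
  linarith

lemma integrableOn_stdCdf_Iic (z : ℝ) : IntegrableOn stdCdf (Iic z) := by
  have h : IntegrableOn (fun s => stdCdf (-s)) (Ioi (-z)) := by
    refine integrableOn_Ioi_deriv_of_nonneg' (g := fun s => -cdfPrimitive (-s)) (l := -0)
      (fun s _ => ?_) (fun s _ => stdCdf_nonneg _) ?_
    · have := ((hasDerivAt_cdfPrimitive (-s)).comp s (hasDerivAt_neg s)).neg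
      refine this.congr_deriv ?_
      ring
    · exact (tendsto_cdfPrimitive_atBot.comp tendsto_neg_atTop_atBot).neg
  have h2 := ((integrableOn_Ici_iff_integrableOn_Ioi).2 h).comp_neg
  simpa using h2

lemma integral_stdCdf_Iic (z : ℝ) : ∫ s in Iic z, stdCdf s = cdfPrimitive z := by
  rw [integral_Iic_of_hasDerivAt_of_tendsto' (fun s _ => hasDerivAt_cdfPrimitive s)
    (integrableOn_stdCdf_Iic z) tendsto_cdfPrimitive_atBot, sub_zero]

lemma integrableOn_one_sub_stdCdf_Ici (z : ℝ) : IntegrableOn (fun s => 1 - stdCdf s) (Ici z) := by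
  have h := (integrableOn_stdCdf_Iic (-z)).comp_neg
  simpa [stdCdf_neg] using h

lemma integral_one_sub_stdCdf_Ici (z : ℝ) :
    ∫ s in Ici z, (1 - stdCdf s) = cdfPrimitive (-z) := by
  rw [integral_Ici_eq_integral_Ioi, ← integral_stdCdf_Iic, ← integral_comp_neg_Ioi z stdCdf]
  simp only [stdCdf_neg]

/-! ### Mills ratio -/

/-- The ratio `Φ/φ`. At `-x` it is the Mills ratio `(1 - Φ(x)) / φ(x)`. -/
def millsRatio (x : ℝ) : ℝ := stdCdf x / stdPdf x

/-- The derivative `1 + x Φ(x) / φ(x)` of `millsRatio`. -/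
def millsSlope (x : ℝ) : ℝ := 1 + x * millsRatio x

lemma hasDerivAt_millsRatio (x : ℝ) : HasDerivAt millsRatio (millsSlope x) x := by
  refine ((hasDerivAt_stdCdf x).div (hasDerivAt_stdPdf x) (stdPdf_pos x).ne').congr_deriv ?_
  have := (stdPdf_pos x).ne'
  simp only [millsSlope, millsRatio]
  field_simp
  ring

lemma hasDerivAt_millsSlope (x : ℝ) :
    HasDerivAt millsSlope (millsRatio x + x * millsSlope x) x := by
  refine (((hasDerivAt_id x).mul (hasDerivAt_millsRatio x)).const_add 1).congr_deriv ?_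
  simp only [id]
  ring

lemma continuous_millsRatio : Continuous millsRatio :=
  continuous_iff_continuousAt.2 fun x => (hasDerivAt_millsRatio x).continuousAt

lemma continuous_millsSlope : Continuous millsSlope :=
  continuous_iff_continuousAt.2 fun x => (hasDerivAt_millsSlope x).continuousAt

lemma millsRatio_mul_stdPdf (x : ℝ) : millsRatio x * stdPdf x = stdCdf x :=
  div_mul_cancel₀ _ (stdPdf_pos x).ne'

lemma millsSlope_nonneg (x : ℝ) : 0 ≤ millsSlope x := by
  have h : millsSlope x * stdPdf x = x * stdCdf x + stdPdf x := by
    rw [millsSlope, ← millsRatio_mul_stdPdf]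
    ring
  exact nonneg_of_mul_nonneg_left (h ▸ mills_upper x) (stdPdf_pos x)

lemma millsRatio_add_mul_millsSlope_nonneg (x : ℝ) : 0 ≤ millsRatio x + x * millsSlope x := by
  have h : (millsRatio x + x * millsSlope x) * stdPdf x
      = (1 + x ^ 2) * stdCdf x + x * stdPdf x := by
    rw [millsSlope, ← millsRatio_mul_stdPdf]
    ring
  exact nonneg_of_mul_nonneg_left (h ▸ mills_lower x) (stdPdf_pos x)

lemma monotone_millsSlope : Monotone millsSlope :=
  monotone_of_deriv_nonneg (fun y => (hasDerivAt_millsSlope y).differentiableAt)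
    fun y => by
      rw [(hasDerivAt_millsSlope y).deriv]
      exact millsRatio_add_mul_millsSlope_nonneg y

lemma monotone_cdfPrimitive : Monotone cdfPrimitive :=
  monotone_of_deriv_nonneg (fun y => (hasDerivAt_cdfPrimitive y).differentiableAt)
    fun y => by
      rw [(hasDerivAt_cdfPrimitive y).deriv]
      exact stdCdf_nonneg y

lemma millsSlope_mul_stdCdf_neg_add (x : ℝ) :
    millsSlope x * stdCdf (-x) + millsSlope (-x) * stdCdf x = 1 := by
  have h1 := millsRatio_mul_stdPdf x
  have h2 := millsRatio_mul_stdPdf (-x)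
  have h3 := stdCdf_neg x
  rw [stdPdf_neg] at h2
  simp only [millsSlope]
  linear_combination h3 + (x * millsRatio (-x)) * h1 - (x * millsRatio x) * h2

/-- The weights with which the second derivative of Stein's solution is averaged add up to one. -/
lemma millsSlope_deriv_mul_cdfPrimitive_add (x : ℝ) :
    (millsRatio x + x * millsSlope x) * cdfPrimitive (-x) +
      (millsRatio (-x) + -x * millsSlope (-x)) * cdfPrimitive x = 1 := by
  have h1 := millsRatio_mul_stdPdf x
  have h2 := millsRatio_mul_stdPdf (-x)
  have h3 := stdCdf_neg x
  rw [stdPdf_neg] at h2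
  have h4 : (millsRatio x + millsRatio (-x)) * stdPdf x = 1 := by linarith
  simp only [millsSlope, cdfPrimitive, stdPdf_neg]
  rw [← h2, ← h1]
  linear_combination h4

/-! ### Stein's equation -/

/-- The bounded solution of Stein's equation `f'(x) - x f(x) = 1(x ≤ t) - Φ(t)`. -/
def steinSol (t x : ℝ) : ℝ :=
  if x ≤ t then millsRatio x * stdCdf (-t) else millsRatio (-x) * stdCdf t

/-- The derivative of `steinSol t`, with its left limit as the value at `t`. -/
def steinDeriv (t x : ℝ) : ℝ :=
  if x ≤ t then millsSlope x * stdCdf (-t) else -millsSlope (-x) * stdCdf t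

lemma steinDeriv_sub_mul_steinSol (t x : ℝ) :
    steinDeriv t x - x * steinSol t x = (if x ≤ t then 1 else 0) - stdCdf t := by
  unfold steinDeriv steinSol
  split_ifs <;> simp only [millsSlope, stdCdf_neg] <;> ring

lemma abs_steinDeriv_le_one (t x : ℝ) : |steinDeriv t x| ≤ 1 := by
  have h := millsSlope_mul_stdCdf_neg_add x
  have hm : Monotone stdCdf := monotone_cdf _
  have h1 := mul_nonneg (millsSlope_nonneg x) (stdCdf_nonneg (-x))
  have h2 := mul_nonneg (millsSlope_nonneg (-x)) (stdCdf_nonneg x)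
  unfold steinDeriv
  split_ifs with hx
  · rw [abs_of_nonneg (mul_nonneg (millsSlope_nonneg x) (stdCdf_nonneg _))]
    have := mul_le_mul_of_nonneg_left (hm (neg_le_neg hx)) (millsSlope_nonneg x)
    linarith
  · rw [neg_mul, abs_neg, abs_of_nonneg (mul_nonneg (millsSlope_nonneg _) (stdCdf_nonneg _))]
    have := mul_le_mul_of_nonneg_left (hm (not_le.1 hx).le) (millsSlope_nonneg (-x))
    linarith

lemma measurable_uncurry_steinDeriv : Measurable fun z : ℝ × ℝ => steinDeriv z.1 z.2 := by
  have h1 := continuous_millsSlope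
  have h2 := continuous_stdCdf
  refine Measurable.ite (measurableSet_le measurable_snd measurable_fst) ?_ ?_
  · exact Continuous.measurable (by fun_prop)
  · exact Continuous.measurable (by fun_prop)

lemma continuous_steinSol (t : ℝ) : Continuous (steinSol t) := by
  have h1 := continuous_millsRatio
  refine Continuous.if_le (by fun_prop) (by fun_prop) continuous_id continuous_const ?_
  rintro x rfl
  simp only [millsRatio, stdPdf_neg]
  ring

lemma hasDerivAt_steinSol {t x : ℝ} (hx : x ≠ t) : HasDerivAt (steinSol t) (steinDeriv t x) x := by
  rcases lt_or_gt_of_ne hx with h | h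
  · have hd := (hasDerivAt_millsRatio x).mul_const (stdCdf (-t))
    rw [steinDeriv, if_pos h.le]
    refine hd.congr_of_eventuallyEq ?_
    filter_upwards [eventually_lt_nhds h] with y hy
    rw [steinSol, if_pos hy.le]
  · have hd := ((hasDerivAt_millsRatio (-x)).comp x (hasDerivAt_neg x)).mul_const (stdCdf t)
    rw [steinDeriv, if_neg h.not_ge]
    refine (hd.congr_of_eventuallyEq ?_).congr_deriv (by ring)
    filter_upwards [eventually_gt_nhds h] with y hy
    rw [steinSol, if_neg (not_le.2 hy)]
    rfl

lemma intervalIntegrable_steinDeriv (t p q : ℝ) :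
    IntervalIntegrable (steinDeriv t) volume p q := by
  rw [intervalIntegrable_iff]
  refine Measure.integrableOn_of_bounded (M := 1) (by simp) ?_ (ae_of_all _ fun x => ?_)
  · exact (measurable_uncurry_steinDeriv.comp measurable_prodMk_left).aestronglyMeasurable
  · exact abs_steinDeriv_le_one t x

lemma steinSol_sub_steinSol (t p q : ℝ) :
    steinSol t p - steinSol t q =
      (p - q) * ∫ u in (0 : ℝ)..1, steinDeriv t ((p - q) * u + q) := by
  rw [← smul_eq_mul, intervalIntegral.smul_integral_comp_mul_add,
    integral_eq_of_hasDerivAt_off_countable (steinSol t) (steinDeriv t) (countable_singleton t)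
      (continuous_steinSol t).continuousOn (fun x hx => hasDerivAt_steinSol hx.2)
      (intervalIntegrable_steinDeriv t _ _)]
  simp

/-- The value of `∫ |steinDeriv t x - steinDeriv t y| dt` for `x ≤ y` is at most `2 (y - x)`: it
vanishes at `y = x`, and its derivative in `y` is at most
`(A'(y) J(-y) + A'(-y) J(y)) + (A(y) Φ(-y) + A(-y) Φ(y)) = 1 + 1`, where `A` is `millsSlope`
and `J` is `cdfPrimitive`. -/
lemma steinVariation_le {x y : ℝ} (hxy : x ≤ y) :
    (millsSlope (-x) - millsSlope (-y)) * cdfPrimitive x +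
      (millsSlope x * (cdfPrimitive (-x) - cdfPrimitive (-y)) +
        millsSlope (-y) * (cdfPrimitive y - cdfPrimitive x)) +
      (millsSlope y - millsSlope x) * cdfPrimitive (-y) ≤ 2 * (y - x) := by
  have hA : ∀ y, HasDerivAt (fun y => millsSlope (-y))
      (-(millsRatio (-y) + -y * millsSlope (-y))) y := fun y =>
    ((hasDerivAt_millsSlope (-y)).comp y (hasDerivAt_neg y)).congr_deriv (by ring)
  have hJ : ∀ y, HasDerivAt (fun y => cdfPrimitive (-y)) (-stdCdf (-y)) y := fun y =>
    ((hasDerivAt_cdfPrimitive (-y)).comp y (hasDerivAt_neg y)).congr_deriv (by ring)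
  let D : ℝ → ℝ := fun y => 2 * y - ((millsSlope (-x) - millsSlope (-y)) * cdfPrimitive x +
      (millsSlope x * (cdfPrimitive (-x) - cdfPrimitive (-y)) +
        millsSlope (-y) * (cdfPrimitive y - cdfPrimitive x)) +
      (millsSlope y - millsSlope x) * cdfPrimitive (-y))
  have hD := fun y => ((hasDerivAt_id y).const_mul 2).sub
    (((((hA y).const_sub (millsSlope (-x))).mul_const (cdfPrimitive x)).add
      ((((hJ y).const_sub (cdfPrimitive (-x))).const_mul (millsSlope x)).add
        ((hA y).mul ((hasDerivAt_cdfPrimitive y).sub_const (cdfPrimitive x))))).add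
      (((hasDerivAt_millsSlope y).sub_const (millsSlope x)).mul (hJ y)))
  have hmono : MonotoneOn D (Ici x) := by
    refine monotoneOn_of_hasDerivWithinAt_nonneg (convex_Ici x)
      (fun y _ => (hD y).continuousAt.continuousWithinAt)
      (fun y _ => (hD y).hasDerivWithinAt) fun y hy => ?_
    rw [interior_Ici] at hy
    -- The derivative of `D` is the sum of the slack in the two monotonicity bounds `h3`, `h4`,
    -- each taken twice.
    have h1 := millsSlope_deriv_mul_cdfPrimitive_add y
    have h2 := millsSlope_mul_stdCdf_neg_add y
    have h3 := mul_nonneg (millsRatio_add_mul_millsSlope_nonneg (-y))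
      (sub_nonneg.2 (monotone_cdfPrimitive (le_of_lt hy)))
    have h4 := mul_nonneg (sub_nonneg.2 (monotone_millsSlope (le_of_lt hy))) (stdCdf_nonneg (-y))
    linarith
  have h := hmono self_mem_Ici hxy hxy
  simp only [D] at h
  linarith

lemma integrable_steinDeriv_sub_of_le {x y : ℝ} (hxy : x ≤ y) :
    Integrable (fun t => steinDeriv t x - steinDeriv t y) ∧
      ∫ t, |steinDeriv t x - steinDeriv t y| ≤ 2 * (y - x) := by
  -- The sign of the difference is constant on each of `(-∞, x)`, `[x, y)` and `[y, ∞)`.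
  set g : ℝ → ℝ := fun t => |steinDeriv t x - steinDeriv t y|
  have hA := monotone_millsSlope
  have e1 : EqOn (fun t => (millsSlope (-x) - millsSlope (-y)) * stdCdf t) g (Iio x) := by
    intro t ht
    have h1 : ¬ x ≤ t := not_le.2 ht
    have h2 : ¬ y ≤ t := fun h => h1 (hxy.trans h)
    simp only [g, steinDeriv, if_neg h1, if_neg h2]
    rw [← sub_mul, abs_mul, abs_of_nonneg (stdCdf_nonneg t), ← abs_neg, abs_of_nonneg]
    · ring
    · linarith [hA (neg_le_neg hxy)]
  have e2 : EqOn (fun t => millsSlope x * stdCdf (-t) + millsSlope (-y) * stdCdf t) g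
      (Ico x y) := by
    intro t ht
    simp only [g, steinDeriv, if_pos ht.1, if_neg (not_le.2 ht.2)]
    rw [abs_of_nonneg]
    · ring
    · have := mul_nonneg (millsSlope_nonneg x) (stdCdf_nonneg (-t))
      have := mul_nonneg (millsSlope_nonneg (-y)) (stdCdf_nonneg t)
      linarith
  have e3 : EqOn (fun t => (millsSlope y - millsSlope x) * (1 - stdCdf t)) g (Ici y) := by
    intro t ht
    simp only [g, steinDeriv, if_pos (hxy.trans (mem_Ici.1 ht)), if_pos (mem_Ici.1 ht)]
    rw [← sub_mul, abs_mul, abs_of_nonneg (stdCdf_nonneg _), ← abs_neg, abs_of_nonneg, stdCdf_neg]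
    · ring
    · linarith [hA hxy]
  have hcont : Continuous fun t => millsSlope x * stdCdf (-t) + millsSlope (-y) * stdCdf t := by
    have := continuous_stdCdf
    fun_prop
  have i1 : IntegrableOn g (Iio x) :=
    IntegrableOn.congr_fun
      (((integrableOn_stdCdf_Iic x).mono_set Iio_subset_Iic_self).const_mul _) e1 measurableSet_Iio
  have i2 : IntegrableOn g (Ico x y) :=
    ((hcont.integrableOn_Icc (a := x) (b := y)).mono_set Ico_subset_Icc_self).congr_fun e2
      measurableSet_Ico
  have i3 : IntegrableOn g (Ici y) :=
    IntegrableOn.congr_fun ((integrableOn_one_sub_stdCdf_Ici y).const_mul _) e3 measurableSet_Ici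
  have i12 : IntegrableOn g (Iio y) := by
    rw [← Iio_union_Ico_eq_Iio hxy]
    exact i1.union i2
  have ig : Integrable g := by
    rw [← integrableOn_univ, ← Iio_union_Ici (a := y)]
    exact i12.union i3
  have v1 : ∫ t in Iio x, g t = (millsSlope (-x) - millsSlope (-y)) * cdfPrimitive x := by
    rw [← setIntegral_congr_fun measurableSet_Iio e1, integral_const_mul,
      ← integral_Iic_eq_integral_Iio, integral_stdCdf_Iic]
  have v2 : ∫ t in Ico x y, g t = millsSlope x * (cdfPrimitive (-x) - cdfPrimitive (-y)) +
      millsSlope (-y) * (cdfPrimitive y - cdfPrimitive x) := by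
    rw [← setIntegral_congr_fun measurableSet_Ico e2, integral_Ico_eq_integral_Ioc,
      ← intervalIntegral.integral_of_le hxy]
    rw [intervalIntegral.integral_eq_sub_of_hasDerivAt
      (f := fun t => millsSlope x * -cdfPrimitive (-t) + millsSlope (-y) * cdfPrimitive t)
      (fun t _ => ?_) (hcont.intervalIntegrable _ _)]
    · ring
    · have h := ((hasDerivAt_cdfPrimitive (-t)).comp t (hasDerivAt_neg t)).neg.const_mul
        (millsSlope x)
      exact (h.add ((hasDerivAt_cdfPrimitive t).const_mul (millsSlope (-y)))).congr_deriv (by ring)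
  have v3 : ∫ t in Ici y, g t = (millsSlope y - millsSlope x) * cdfPrimitive (-y) := by
    rw [← setIntegral_congr_fun measurableSet_Ici e3, integral_const_mul,
      integral_one_sub_stdCdf_Ici]
  have hm : ∀ x, Measurable fun t => steinDeriv t x := fun x =>
    measurable_uncurry_steinDeriv.comp measurable_prodMk_right
  refine ⟨(integrable_norm_iff ((hm x).sub (hm y)).aestronglyMeasurable).1 ig, ?_⟩
  have hsplit : ∫ t, g t = (∫ t in Iio x, g t) + (∫ t in Ico x y, g t) + ∫ t in Ici y, g t := by
    rw [← setIntegral_univ, ← Iio_union_Ici (a := y),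
      setIntegral_union (by simp [disjoint_left]) measurableSet_Ici i12 i3,
      ← Iio_union_Ico_eq_Iio hxy,
      setIntegral_union (by rw [disjoint_left]; intro a h1 h2; exact not_le.2 h1 h2.1)
        measurableSet_Ico i1 i2]
  rw [hsplit, v1, v2, v3]
  exact steinVariation_le hxy

/-- Averaged over `t`, the derivative of Stein's solution is `2`-Lipschitz in `L¹`. This contains
the classical bound `‖f''‖ ≤ 2 ‖h'‖` for the solutions with Lipschitz right-hand side `h`. -/
lemma lintegral_enorm_steinDeriv_sub_le (x y : ℝ) :
    ∫⁻ t, ‖steinDeriv t x - steinDeriv t y‖ₑ ≤ ENNReal.ofReal (2 * |x - y|) := by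
  wlog hxy : x ≤ y generalizing x y
  · have := this y x (not_le.1 hxy).le
    rw [abs_sub_comm]
    refine le_trans (le_of_eq (lintegral_congr fun t => ?_)) this
    rw [← enorm_neg, neg_sub]
  obtain ⟨hi, hle⟩ := integrable_steinDeriv_sub_of_le hxy
  rw [← ofReal_integral_norm_eq_lintegral_enorm hi, abs_sub_comm, abs_of_nonneg (sub_nonneg.2 hxy)]
  exact ENNReal.ofReal_le_ofReal hle

/-- The difference between the derivative of Stein's solution at `x` and its mean over the
segment from `q` to `p`. -/
def steinDefect (x p q t : ℝ) : ℝ :=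
  steinDeriv t x - ∫ u in (0 : ℝ)..1, steinDeriv t ((p - q) * u + q)

lemma steinDefect_integrable (x p q : ℝ) :
    Integrable (steinDefect x p q) ∧ ∫ t, |steinDefect x p q t| ≤ |x - p| + |x - q| := by
  have hpair : Measurable fun z : ℝ × ℝ => steinDeriv z.1 ((p - q) * z.2 + q) :=
    measurable_uncurry_steinDeriv.comp
      (f := fun z : ℝ × ℝ => (z.1, (p - q) * z.2 + q)) (by fun_prop)
  have hx : Measurable fun t => steinDeriv t x :=
    measurable_uncurry_steinDeriv.comp measurable_prodMk_right
  have hmeas : AEStronglyMeasurable (steinDefect x p q) volume := by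
    refine hx.aestronglyMeasurable.sub ?_
    simp only [intervalIntegral.integral_of_le zero_le_one]
    exact (hpair.stronglyMeasurable.integral_prod_right').aestronglyMeasurable
  have hpt : ∀ t, ‖steinDefect x p q t‖ₑ ≤
      ∫⁻ u in Ioc (0 : ℝ) 1, ‖steinDeriv t x - steinDeriv t ((p - q) * u + q)‖ₑ := by
    intro t
    have hi : IntervalIntegrable (fun u => steinDeriv t ((p - q) * u + q)) volume 0 1 := by
      rw [intervalIntegrable_iff]
      refine Measure.integrableOn_of_bounded (M := 1) (by simp)
        (hpair.comp measurable_prodMk_left).aestronglyMeasurable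
        (ae_of_all _ fun u => abs_steinDeriv_le_one t _)
    have e : steinDefect x p q t =
        ∫ u in Ioc (0 : ℝ) 1, (steinDeriv t x - steinDeriv t ((p - q) * u + q)) := by
      rw [← intervalIntegral.integral_of_le zero_le_one,
        intervalIntegral.integral_sub intervalIntegrable_const hi, steinDefect]
      simp
    rw [e]
    exact enorm_integral_le_lintegral_enorm _
  have hbound : ∫⁻ t, ‖steinDefect x p q t‖ₑ ≤ ENNReal.ofReal (|x - p| + |x - q|) := by
    calc ∫⁻ t, ‖steinDefect x p q t‖ₑ
        ≤ ∫⁻ t, ∫⁻ u in Ioc (0 : ℝ) 1, ‖steinDeriv t x - steinDeriv t ((p - q) * u + q)‖ₑ :=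
          lintegral_mono hpt
      _ = ∫⁻ u in Ioc (0 : ℝ) 1, ∫⁻ t, ‖steinDeriv t x - steinDeriv t ((p - q) * u + q)‖ₑ := by
          refine lintegral_lintegral_swap (Measurable.aemeasurable ?_)
          exact ((hx.comp measurable_fst).sub hpair).enorm
      _ ≤ ∫⁻ u in Ioc (0 : ℝ) 1, ENNReal.ofReal (2 * (u * |x - p| + (1 - u) * |x - q|)) := by
          refine setLIntegral_mono (by fun_prop) fun u hu => ?_
          refine (lintegral_enorm_steinDeriv_sub_le _ _).trans (ENNReal.ofReal_le_ofReal ?_)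
          refine mul_le_mul_of_nonneg_left ?_ two_pos.le
          rw [show x - ((p - q) * u + q) = u * (x - p) + (1 - u) * (x - q) by ring]
          refine (abs_add_le _ _).trans (le_of_eq ?_)
          rw [abs_mul, abs_mul, abs_of_pos hu.1, abs_of_nonneg (sub_nonneg.2 hu.2)]
      _ = ENNReal.ofReal (|x - p| + |x - q|) := by
          have hc : Continuous fun u : ℝ => 2 * (u * |x - p| + (1 - u) * |x - q|) := by fun_prop
          rw [← ofReal_integral_eq_lintegral_ofReal
            ((hc.integrableOn_Icc (a := 0) (b := 1)).mono_set Ioc_subset_Icc_self)]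
          · congr 1
            rw [← intervalIntegral.integral_of_le zero_le_one,
              intervalIntegral.integral_eq_sub_of_hasDerivAt
              (f := fun u : ℝ => u ^ 2 * |x - p| + (2 * u - u ^ 2) * |x - q|)
              (fun u _ => ?_) (hc.intervalIntegrable _ _)]
            · ring
            · have h1 := ((hasDerivAt_id u).pow 2).mul_const |x - p|
              have h2 := (((hasDerivAt_id u).const_mul 2).sub
                ((hasDerivAt_id u).pow 2)).mul_const |x - q|
              refine (h1.add h2).congr_deriv ?_
              simp only [id]
              push_cast
              ring
          · filter_upwards [ae_restrict_mem measurableSet_Ioc] with u hu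
            have := hu.1.le
            have := sub_nonneg.2 hu.2
            simp only [Pi.zero_apply]
            positivity
  have hint : Integrable (steinDefect x p q) :=
    ⟨hmeas, hbound.trans_lt ENNReal.ofReal_lt_top⟩
  refine ⟨hint, ?_⟩
  rw [← ofReal_integral_norm_eq_lintegral_enorm hint] at hbound
  exact (ENNReal.ofReal_le_ofReal_iff (by positivity)).1 hbound

end

end SimpleRandomSampling

namespace SimpleRandomSampling

open Finset

/-! ### Sums over subsets of given size -/

section Subsets

variable {α : Type*} [DecidableEq α]

/-- Double counting of the pairs consisting of a subset and one further element. -/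
lemma sum_powersetCard_sum_sdiff {M : Type*} [AddCommMonoid M] (s : Finset α) (m : ℕ)
    (G : Finset α → α → M) :
    ∑ R ∈ s.powersetCard m, ∑ k ∈ s \ R, G R k =
      ∑ S ∈ s.powersetCard (m + 1), ∑ k ∈ S, G (S.erase k) k := by
  rw [sum_sigma', sum_sigma']
  refine sum_bij' (fun x _ => ⟨insert x.2 x.1, x.2⟩) (fun x _ => ⟨x.1.erase x.2, x.2⟩)
    ?_ ?_ ?_ ?_ ?_
  · rintro ⟨R, k⟩ h
    simp only [mem_sigma, mem_powersetCard, mem_sdiff] at h ⊢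
    obtain ⟨⟨hR, hc⟩, hk, hkR⟩ := h
    exact ⟨⟨insert_subset hk hR, by rw [card_insert_of_notMem hkR, hc]⟩, mem_insert_self _ _⟩
  · rintro ⟨S, k⟩ h
    simp only [mem_sigma, mem_powersetCard, mem_sdiff] at h ⊢
    obtain ⟨⟨hS, hc⟩, hk⟩ := h
    exact ⟨⟨(erase_subset _ _).trans hS, by rw [card_erase_of_mem hk, hc]; rfl⟩, hS hk,
      notMem_erase _ _⟩
  · rintro ⟨R, k⟩ h
    simp only [mem_sigma, mem_sdiff] at h
    simp [erase_insert h.2.2]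
  · rintro ⟨S, k⟩ h
    simp only [mem_sigma] at h
    simp [insert_erase h.2]
  · rintro ⟨R, k⟩ h
    simp only [mem_sigma, mem_sdiff] at h
    simp [erase_insert h.2.2]

lemma sum_powersetCard_insert {M : Type*} [AddCommMonoid M] {s : Finset α} {x : α} (hx : x ∉ s)
    (m : ℕ) (F : Finset α → M) :
    ∑ S ∈ (insert x s).powersetCard (m + 1), F S =
      ∑ S ∈ s.powersetCard (m + 1), F S + ∑ S ∈ s.powersetCard m, F (insert x S) := by
  rw [powersetCard_succ_insert hx, sum_union, sum_image]
  · intro S hS T hT h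
    have hS' := fun h => hx ((mem_powersetCard.1 hS).1 h)
    have hT' := fun h => hx ((mem_powersetCard.1 hT).1 h)
    rw [← erase_insert hS', ← erase_insert hT', h]
  · rw [disjoint_left]
    intro S hS hS'
    obtain ⟨T, -, rfl⟩ := mem_image.1 hS'
    exact hx ((mem_powersetCard.1 hS).1 (mem_insert_self x T))

/-- The elements of a uniformly chosen `m`-subset are uniformly distributed over `s`. -/
lemma card_mul_sum_powersetCard_sum (s : Finset α) (m : ℕ) (g : α → ℝ) :
    (s.card : ℝ) * ∑ R ∈ s.powersetCard m, ∑ k ∈ R, g k =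
      m * (s.card.choose m : ℝ) * ∑ k ∈ s, g k := by
  induction m with
  | zero => simp
  | succ m ih =>
    have h1 : ∑ R ∈ s.powersetCard (m + 1), ∑ k ∈ R, g k =
        s.card.choose m * ∑ k ∈ s, g k - ∑ R ∈ s.powersetCard m, ∑ k ∈ R, g k := by
      rw [← sum_powersetCard_sum_sdiff s m fun _ k => g k, ← card_powersetCard, ← nsmul_eq_mul,
        ← sum_const, ← sum_sub_distrib]
      refine sum_congr rfl fun R hR => ?_
      rw [eq_sub_iff_add_eq, sum_sdiff (mem_powersetCard.1 hR).1]
    have h2 : (s.card.choose (m + 1) : ℝ) * (m + 1) = s.card.choose m * (s.card - m) := by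
      rcases le_or_gt m s.card with h | h
      · have := Nat.choose_succ_right_eq s.card m
        rw [← Nat.cast_sub h]
        exact_mod_cast this
      · simp [Nat.choose_eq_zero_of_lt h, Nat.choose_eq_zero_of_lt (h.trans m.lt_succ_self)]
    rw [h1, mul_sub, ih]
    push_cast
    linear_combination (-∑ k ∈ s, g k) * h2

lemma card_mul_sum_powersetCard_sum_sdiff (s : Finset α) (m : ℕ) (g : α → ℝ) :
    (s.card : ℝ) * ∑ R ∈ s.powersetCard m, ∑ k ∈ s \ R, g k =
      (s.card - m) * (s.card.choose m : ℝ) * ∑ k ∈ s, g k := by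
  have h : ∑ R ∈ s.powersetCard m, ∑ k ∈ s \ R, g k =
      s.card.choose m * ∑ k ∈ s, g k - ∑ R ∈ s.powersetCard m, ∑ k ∈ R, g k := by
    rw [← card_powersetCard, ← nsmul_eq_mul, ← sum_const, ← sum_sub_distrib]
    refine sum_congr rfl fun R hR => ?_
    rw [eq_sub_iff_add_eq, sum_sdiff (mem_powersetCard.1 hR).1]
  rw [h, mul_sub, card_mul_sum_powersetCard_sum]
  ring

end Subsets

/-! ### The zero-bias coupling of samples -/

section Samples

variable {N : ℕ}

lemma card_univ_sdiff_pair {i j : Fin N} (hij : i ≠ j) :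
    (univ \ {i, j} : Finset (Fin N)).card = N - 2 := by
  rw [card_sdiff_of_subset (subset_univ _), card_pair hij, card_univ, Fintype.card_fin]

lemma cast_card_univ_sdiff_pair {i j : Fin N} (hij : i ≠ j) :
    ((univ \ {i, j} : Finset (Fin N)).card : ℝ) = N - 2 := by
  have h2 : 2 ≤ N := by
    have := card_le_univ ({i, j} : Finset (Fin N))
    rwa [card_pair hij, Fintype.card_fin] at this
  rw [card_univ_sdiff_pair hij, Nat.cast_sub h2]
  norm_num

/-- The coupling of a sample with the sample forced to contain exactly one of the labels `i`, `j`.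
With `R` denoting the part of the latter outside `{i, j}`, a sample containing one of `i`, `j` is
`R` with this label added; a sample containing neither has one further element of its own, and a
sample containing both lacks one element of `R`. -/
lemma sum_samples_eq (c : Fin N → ℝ) (f : ℝ → ℝ) {i j : Fin N} (hij : i ≠ j) {m : ℕ}
    (hm : m + 2 < N) :
    ∑ S ∈ (univ : Finset (Fin N)).powersetCard (m + 2), f (∑ k ∈ S, c k) =
      ∑ R ∈ (univ \ {i, j} : Finset (Fin N)).powersetCard (m + 1),
        (f (∑ k ∈ R, c k + c i) + f (∑ k ∈ R, c k + c j) +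
          (1 / ((m : ℝ) + 2)) * ∑ k ∈ (univ \ {i, j}) \ R, f (∑ k ∈ R, c k + c k) +
          (1 / ((N : ℝ) - (m + 2))) * ∑ k ∈ R, f (∑ k ∈ R, c k - c k + c i + c j)) := by
  set s : Finset (Fin N) := univ \ {i, j} with hs
  have hi : i ∉ s := by simp [hs]
  have hj : j ∉ s := by simp [hs]
  have hi' : i ∉ insert j s := by simp [hij, hi]
  have huniv : (univ : Finset (Fin N)) = insert i (insert j s) := by
    ext k
    simp only [hs, mem_univ, mem_insert, mem_sdiff, mem_singleton]
    tauto
  have hnone : ((m : ℝ) + 2) * ∑ S ∈ s.powersetCard (m + 2), f (∑ k ∈ S, c k) =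
      ∑ R ∈ s.powersetCard (m + 1), ∑ k ∈ s \ R, f (∑ k ∈ R, c k + c k) := by
    rw [sum_powersetCard_sum_sdiff s (m + 1) fun R k => f (∑ k ∈ R, c k + c k), mul_sum]
    refine sum_congr rfl fun S hS => ?_
    have e : ∀ x ∈ S, f (∑ k ∈ S.erase x, c k + c x) = f (∑ k ∈ S, c k) := fun x hx => by
      rw [sum_erase_add _ _ hx]
    rw [sum_congr rfl e, sum_const, (mem_powersetCard.1 hS).2, nsmul_eq_mul]
    push_cast
    ring
  have hboth : ((N : ℝ) - (m + 2)) *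
      ∑ T ∈ s.powersetCard m, f (∑ k ∈ T, c k + c i + c j) =
      ∑ R ∈ s.powersetCard (m + 1), ∑ k ∈ R, f (∑ k ∈ R, c k - c k + c i + c j) := by
    have h := sum_powersetCard_sum_sdiff s m fun T _ => f (∑ k ∈ T, c k + c i + c j)
    have e : ∑ R ∈ s.powersetCard (m + 1), ∑ k ∈ R, f (∑ k ∈ R, c k - c k + c i + c j) =
        ∑ R ∈ s.powersetCard (m + 1), ∑ k ∈ R, f (∑ k ∈ R.erase k, c k + c i + c j) :=
      sum_congr rfl fun R _ => sum_congr rfl fun k hk => by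
        rw [← sum_erase_add R c hk, add_sub_cancel_right]
    rw [e, ← h, mul_sum]
    refine sum_congr rfl fun T hT => ?_
    rw [sum_const, nsmul_eq_mul, card_sdiff_of_subset (mem_powersetCard.1 hT).1,
      Nat.cast_sub (card_le_card (mem_powersetCard.1 hT).1), cast_card_univ_sdiff_pair hij,
      (mem_powersetCard.1 hT).2]
    ring
  have h1 : (m : ℝ) + 2 ≠ 0 := by positivity
  have h2 : (N : ℝ) - (m + 2) ≠ 0 := by
    have : ((m + 2 : ℕ) : ℝ) < N := by exact_mod_cast hm
    push_cast at this
    linarith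
  replace hnone := eq_div_of_mul_eq h1 ((mul_comm _ _).trans hnone)
  replace hboth := eq_div_of_mul_eq h2 ((mul_comm _ _).trans hboth)
  have hsumj : ∀ T ∈ s.powersetCard (m + 1), f (∑ k ∈ insert j T, c k) = f (∑ k ∈ T, c k + c j) :=
    fun T hT => by
      rw [sum_insert fun h => hj ((mem_powersetCard.1 hT).1 h), add_comm]
  have hsumi : ∀ T ∈ s.powersetCard (m + 1), f (∑ k ∈ insert i T, c k) = f (∑ k ∈ T, c k + c i) :=
    fun T hT => by
      rw [sum_insert fun h => hi ((mem_powersetCard.1 hT).1 h), add_comm]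
  have hsumij : ∀ T ∈ s.powersetCard m,
      f (∑ k ∈ insert i (insert j T), c k) = f (∑ k ∈ T, c k + c i + c j) := fun T hT => by
    have hT' := (mem_powersetCard.1 hT).1
    have hiT : i ∉ insert j T := fun h => hi' (insert_subset_insert j hT' h)
    rw [sum_insert hiT, sum_insert fun h => hj (hT' h)]
    congr 1
    ring
  rw [huniv, sum_powersetCard_insert hi', sum_powersetCard_insert hj, sum_powersetCard_insert hj,
    sum_congr rfl hsumi, sum_congr rfl hsumj, sum_congr rfl hsumij, hnone, hboth]
  simp only [sum_add_distrib, ← mul_sum]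
  ring

/-- Exchanging a sampled and an unsampled label: the discrete integration by parts behind the
zero-bias transformation of a sample sum. -/
lemma sum_samples_mul_eq (c : Fin N → ℝ) (hc : ∑ k, c k = 0) (f : ℝ → ℝ) (m : ℕ) :
    2 * N * ∑ S ∈ (univ : Finset (Fin N)).powersetCard (m + 1),
        (∑ k ∈ S, c k) * f (∑ k ∈ S, c k) =
      ∑ i, ∑ j, (c i - c j) * ∑ R ∈ (univ \ {i, j} : Finset (Fin N)).powersetCard m,
        (f (∑ k ∈ R, c k + c i) - f (∑ k ∈ R, c k + c j)) := by
  have hexch : ∀ S : Finset (Fin N), (N : ℝ) * ∑ k ∈ S, c k =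
      ∑ i ∈ S, ∑ j ∈ Sᶜ, (c i - c j) := by
    intro S
    have h1 : ∑ k ∈ S, c k + ∑ k ∈ Sᶜ, c k = 0 := by rw [sum_add_sum_compl, hc]
    have h2 : (S.card : ℝ) + (Sᶜ.card : ℝ) = N := by
      rw [← Nat.cast_add, card_add_card_compl, Fintype.card_fin]
    simp only [sum_sub_distrib, sum_const, nsmul_eq_mul, ← mul_sum]
    rw [← h2]
    linear_combination (S.card : ℝ) * h1
  have hone : (N : ℝ) * ∑ S ∈ (univ : Finset (Fin N)).powersetCard (m + 1),
        (∑ k ∈ S, c k) * f (∑ k ∈ S, c k) =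
      ∑ i, ∑ j, (c i - c j) * ∑ R ∈ (univ \ {i, j} : Finset (Fin N)).powersetCard m,
        f (∑ k ∈ R, c k + c i) := by
    calc _ = ∑ S ∈ (univ : Finset (Fin N)).powersetCard (m + 1), ∑ i ∈ S,
          ∑ j ∈ (insert i (S.erase i))ᶜ, (c i - c j) * f (∑ k ∈ S.erase i, c k + c i) := by
          rw [mul_sum]
          refine sum_congr rfl fun S _ => ?_
          rw [← mul_assoc, hexch, sum_mul]
          refine sum_congr rfl fun i hi => ?_
          rw [sum_mul, insert_erase hi, sum_erase_add _ _ hi]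
      _ = ∑ R ∈ (univ : Finset (Fin N)).powersetCard m, ∑ i ∈ univ \ R,
          ∑ j ∈ (insert i R)ᶜ, (c i - c j) * f (∑ k ∈ R, c k + c i) :=
          (sum_powersetCard_sum_sdiff univ m fun R i =>
            ∑ j ∈ (insert i R)ᶜ, (c i - c j) * f (∑ k ∈ R, c k + c i)).symm
      _ = ∑ R ∈ (univ : Finset (Fin N)).powersetCard m, ∑ z ∈ (univ \ R) ×ˢ (univ \ R),
          (c z.1 - c z.2) * f (∑ k ∈ R, c k + c z.1) := by
          refine sum_congr rfl fun R _ => ?_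
          rw [sum_product]
          refine sum_congr rfl fun i _ => sum_subset (fun j hj => ?_) fun j hj hj' => ?_
          · simp only [mem_compl, mem_insert, not_or] at hj
            simp [hj.2]
          · simp only [mem_compl, mem_insert, not_not, mem_sdiff, mem_univ, true_and] at hj hj'
            rw [hj'.resolve_right hj]
            ring
      _ = ∑ z : Fin N × Fin N, ∑ R ∈ (univ \ {z.1, z.2} : Finset (Fin N)).powersetCard m,
          (c z.1 - c z.2) * f (∑ k ∈ R, c k + c z.1) := by
          refine sum_comm' fun R z => ?_
          simp only [mem_powersetCard, mem_product, mem_sdiff, mem_univ, true_and, subset_iff,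
            mem_insert, mem_singleton]
          constructor
          · rintro ⟨h, h1, h2⟩
            refine ⟨⟨fun x hx => ?_, h.2⟩, trivial⟩
            rintro (rfl | rfl)
            exacts [h1 hx, h2 hx]
          · rintro ⟨⟨h, h'⟩, -⟩
            exact ⟨⟨fun _ _ => trivial, h'⟩, fun hz => h hz (Or.inl rfl),
              fun hz => h hz (Or.inr rfl)⟩
      _ = _ := by
          rw [Fintype.sum_prod_type]
          simp only [mul_sum]
  have htwo : ∑ i, ∑ j, (c i - c j) * ∑ R ∈ (univ \ {i, j} : Finset (Fin N)).powersetCard m,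
        f (∑ k ∈ R, c k + c i) =
      -∑ i, ∑ j, (c i - c j) * ∑ R ∈ (univ \ {i, j} : Finset (Fin N)).powersetCard m,
        f (∑ k ∈ R, c k + c j) := by
    rw [sum_comm, ← sum_neg_distrib]
    refine sum_congr rfl fun i _ => ?_
    rw [← sum_neg_distrib]
    refine sum_congr rfl fun j _ => ?_
    rw [pair_comm j i]
    ring
  simp only [sum_sub_distrib, mul_sub] at htwo ⊢
  linarith

end Samples

/-! ### Third moments of differences -/

section Moments

variable {ι : Type*} [Fintype ι]

lemma sum_sq_mul_sum_abs_le (c : ι → ℝ) :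
    (∑ i, c i ^ 2) * ∑ i, |c i| ≤ Fintype.card ι * ∑ i, |c i| ^ 3 := by
  -- The weighted arithmetic-geometric mean inequality.
  have h : ∀ x y : ℝ, 0 ≤ x → 0 ≤ y → x ^ 2 * y ≤ (2 * x ^ 3 + y ^ 3) / 3 := fun x y hx hy => by
    nlinarith [mul_nonneg (sq_nonneg (x - y)) (add_nonneg (add_nonneg hx hx) hy)]
  calc (∑ i, c i ^ 2) * ∑ i, |c i| = ∑ i, ∑ j, |c i| ^ 2 * |c j| := by
        rw [sum_mul_sum]
        simp only [sq_abs]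
    _ ≤ ∑ i, ∑ j, (2 * |c i| ^ 3 + |c j| ^ 3) / 3 :=
        sum_le_sum fun i _ => sum_le_sum fun j _ => h _ _ (abs_nonneg _) (abs_nonneg _)
    _ = _ := by
        simp only [← sum_div, sum_add_distrib, sum_const, card_univ, nsmul_eq_mul, ← mul_sum]
        ring

lemma sum_sum_sub_sq (c : ι → ℝ) (hc : ∑ k, c k = 0) :
    ∑ i, ∑ j, (c i - c j) ^ 2 = 2 * Fintype.card ι * ∑ i, c i ^ 2 := by
  have h : ∀ i j, (c i - c j) ^ 2 = c i ^ 2 + c j ^ 2 - 2 * c i * c j := fun i j => by ring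
  simp only [h, sum_sub_distrib, sum_add_distrib, ← mul_sum, hc, mul_zero, sum_const, card_univ,
    nsmul_eq_mul]
  ring

/-- Bounding only the last factor by `|c i| + |c j|` keeps the terms linear in `c i` or `c j`, which
sum to zero. -/
lemma sum_sum_sub_sq_mul_abs_le (c : ι → ℝ) (hc : ∑ k, c k = 0) :
    ∑ i, ∑ j, (c i - c j) ^ 2 * |c i - c j| ≤ 4 * Fintype.card ι * ∑ i, |c i| ^ 3 := by
  have h : ∀ i j, (c i - c j) ^ 2 * |c i - c j| ≤ |c i| ^ 3 + |c j| ^ 3 + c i ^ 2 * |c j| +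
      |c i| * c j ^ 2 - 2 * (c i * |c i|) * c j - c i * (2 * (c j * |c j|)) := fun i j => by
    have h1 := mul_le_mul_of_nonneg_left (abs_sub (c i) (c j)) (sq_nonneg (c i - c j))
    have h2 : |c i| ^ 3 = c i ^ 2 * |c i| := by rw [← sq_abs]; ring
    have h3 : |c j| ^ 3 = c j ^ 2 * |c j| := by rw [← sq_abs]; ring
    rw [h2, h3]
    linarith
  refine (sum_le_sum fun i _ => sum_le_sum fun j _ => h i j).trans ?_
  simp only [sum_sub_distrib, sum_add_distrib, ← mul_sum, ← sum_mul, hc, mul_zero, zero_mul,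
    sum_const, card_univ, nsmul_eq_mul, sub_zero]
  linarith [sum_sq_mul_sum_abs_le c]

lemma sum_sum_sum_sub_sq_mul_abs_le (c : ι → ℝ) (hc : ∑ k, c k = 0) :
    ∑ i, ∑ j, ∑ k, (c i - c j) ^ 2 * |c k - c i| ≤
      4 * (Fintype.card ι : ℝ) ^ 2 * ∑ i, |c i| ^ 3 := by
  have h : ∀ i j k, (c i - c j) ^ 2 * |c k - c i| ≤ |c i| ^ 3 + c i ^ 2 * |c k| +
      |c i| * c j ^ 2 + c j ^ 2 * |c k| - 2 * (c i * |c i|) * c j - 2 * c i * c j * |c k| :=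
    fun i j k => by
      have h1 := mul_le_mul_of_nonneg_left (abs_sub (c k) (c i)) (sq_nonneg (c i - c j))
      have h2 : |c i| ^ 3 = c i ^ 2 * |c i| := by rw [← sq_abs]; ring
      rw [h2]
      linarith
  refine (sum_le_sum fun i _ => sum_le_sum fun j _ => sum_le_sum fun k _ => h i j k).trans ?_
  have hS := mul_le_mul_of_nonneg_left (sum_sq_mul_sum_abs_le c)
    (Nat.cast_nonneg (α := ℝ) (Fintype.card ι))
  simp only [sum_sub_distrib, sum_add_distrib, ← mul_sum, ← sum_mul, hc, mul_zero, zero_mul,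
    sum_const, card_univ, nsmul_eq_mul, sub_zero]
  linarith

end Moments

/-! ### The `L¹` bound for sums over random subsets -/

section Bound

/-- The function `g` is integrable over the real line, with `L¹` norm at most `b`. -/
def L1NormLE (g : ℝ → ℝ) (b : ℝ) : Prop := Integrable g ∧ ∫ t, |g t| ≤ b

lemma L1NormLE.mono {g : ℝ → ℝ} {b b' : ℝ} (h : L1NormLE g b) (hb : b ≤ b') : L1NormLE g b' :=
  ⟨h.1, h.2.trans hb⟩

lemma L1NormLE.add {g g' : ℝ → ℝ} {b b' : ℝ} (h : L1NormLE g b) (h' : L1NormLE g' b') :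
    L1NormLE (fun t => g t + g' t) (b + b') := by
  refine ⟨h.1.add h'.1, ?_⟩
  calc ∫ t, |g t + g' t| ≤ ∫ t, (|g t| + |g' t|) :=
        integral_mono (h.1.add h'.1).abs (h.1.abs.add h'.1.abs) fun t => abs_add_le _ _
    _ = (∫ t, |g t|) + ∫ t, |g' t| := integral_add h.1.abs h'.1.abs
    _ ≤ b + b' := add_le_add h.2 h'.2

lemma L1NormLE.const_mul {g : ℝ → ℝ} {b a : ℝ} (h : L1NormLE g b) (ha : 0 ≤ a) :
    L1NormLE (fun t => a * g t) (a * b) := by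
  refine ⟨h.1.const_mul a, ?_⟩
  simp only [abs_mul, abs_of_nonneg ha, integral_const_mul]
  exact mul_le_mul_of_nonneg_left h.2 ha

lemma L1NormLE.sum {ι : Type*} (s : Finset ι) {g : ι → ℝ → ℝ} {b : ι → ℝ}
    (h : ∀ i ∈ s, L1NormLE (g i) (b i)) : L1NormLE (fun t => ∑ i ∈ s, g i t) (∑ i ∈ s, b i) := by
  classical
  induction s using Finset.induction_on with
  | empty => exact ⟨by simp, by simp⟩
  | insert i s hi ih =>
    simp only [sum_insert hi]
    exact (h i (mem_insert_self i s)).add (ih fun j hj => h j (mem_insert_of_mem hj))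

variable {N : ℕ}

/-- The expectation of the derivative of Stein's solution at the zero-biased sum, given that the
exchanged labels are `i` and `j` and that the remaining sample is `R`. -/
noncomputable def biasedSteinDeriv (c : Fin N → ℝ) (i j : Fin N) (R : Finset (Fin N)) (t : ℝ) : ℝ :=
  ∫ u in (0 : ℝ)..1,
    steinDeriv t ((∑ k ∈ R, c k + c i - (∑ k ∈ R, c k + c j)) * u + (∑ k ∈ R, c k + c j))

lemma l1NormLE_steinDeriv_sub_biasedSteinDeriv (c : Fin N → ℝ) (i j : Fin N)
    (R : Finset (Fin N)) (x : ℝ) :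
    L1NormLE (fun t => steinDeriv t x - biasedSteinDeriv c i j R t)
      (|x - (∑ k ∈ R, c k + c i)| + |x - (∑ k ∈ R, c k + c j)|) :=
  steinDefect_integrable x _ _

/-- The reciprocal `κ` of the probability weight `n (N - n) / (N (N - 1))`; it is the ratio of the
number of samples of size `n` to the number of `(n - 1)`-subsets avoiding two given labels. -/
noncomputable def sampleRatio (n N : ℝ) : ℝ := N * (N - 1) / (n * (N - n))

lemma sampleRatio_eq {n N : ℝ} (hn : n ≠ 0) (hN : N - n ≠ 0) :
    sampleRatio n N = 2 + 1 / n * (N - 2 - (n - 1)) + 1 / (N - n) * (n - 1) := by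
  unfold sampleRatio
  field_simp
  ring

lemma choose_eq_sampleRatio_mul {m N : ℕ} (hm : m + 2 < N) :
    (N.choose (m + 2) : ℝ) = sampleRatio ((m : ℝ) + 2) N * ((N - 2).choose (m + 1) : ℝ) := by
  obtain ⟨d, rfl⟩ := Nat.exists_eq_add_of_lt hm
  have e1 : (m + 2 + d + 1) = (m + 1 + d) + 2 := by ring
  have h1 := Nat.add_one_mul_choose_eq (m + 1 + d + 1) (m + 1)
  have h2 := Nat.choose_mul_succ_eq (m + 1 + d) (m + 1)
  rw [e1, Nat.add_sub_cancel]
  have e2 : m + 1 + d + 1 - (m + 1) = d + 1 := by omega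
  rw [e2] at h2
  have h1' : ((m : ℝ) + 1 + d + 1 + 1) * ((m + 1 + d + 1).choose (m + 1) : ℝ) =
      ((m + 1 + d + 2).choose (m + 2) : ℝ) * (m + 1 + 1) := by exact_mod_cast h1
  have h2' : ((m + 1 + d).choose (m + 1) : ℝ) * ((m : ℝ) + 1 + d + 1) =
      ((m + 1 + d + 1).choose (m + 1) : ℝ) * (d + 1) := by exact_mod_cast h2
  unfold sampleRatio
  push_cast
  have h3 : (m : ℝ) + 1 + d + 2 - (m + 2) = d + 1 := by ring
  rw [h3, div_mul_eq_mul_div, eq_div_iff (by positivity)]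
  linear_combination (-(d + 1) : ℝ) * h1' - ((m : ℝ) + 1 + d + 1 + 1) * h2'

/-- The `L¹` estimate resulting from the coupling of the sample with its zero-biased version, for
given exchanged labels. -/
lemma l1NormLE_sum_steinDeriv_sub (c : Fin N → ℝ) {i j : Fin N} (hij : i ≠ j) {m : ℕ}
    (hm : m + 3 < N) :
    L1NormLE (fun t =>
        ∑ S ∈ (univ : Finset (Fin N)).powersetCard (m + 2), steinDeriv t (∑ k ∈ S, c k) -
          sampleRatio ((m : ℝ) + 2) N *
            ∑ R ∈ (univ \ {i, j} : Finset (Fin N)).powersetCard (m + 1), biasedSteinDeriv c i j R t)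
      (((N - 2).choose (m + 1) : ℝ) * (2 * |c i - c j| +
        (sampleRatio ((m : ℝ) + 2) N - 2) / (N - 2) * ∑ k, (|c k - c i| + |c k - c j|))) := by
  set s : Finset (Fin N) := univ \ {i, j} with hs
  have hscard : (s.card : ℝ) = N - 2 := cast_card_univ_sdiff_pair hij
  have hN : (m : ℝ) + 3 < N := by exact_mod_cast hm
  have hscard' : s.card = N - 2 := card_univ_sdiff_pair hij
  have hx : (m : ℝ) + 2 ≠ 0 := by positivity
  have hy : (N : ℝ) - (m + 2) ≠ 0 := by linarith
  have hκ := sampleRatio_eq hx hy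
  set κ := sampleRatio ((m : ℝ) + 2) N
  set x : ℝ := 1 / ((m : ℝ) + 2) with hxdef
  set y : ℝ := 1 / ((N : ℝ) - (m + 2)) with hydef
  have hx0 : 0 ≤ x := by positivity
  have hy0 : 0 ≤ y := div_nonneg one_pos.le (by linarith)
  let δ : Finset (Fin N) → ℝ → ℝ → ℝ := fun R z t => steinDeriv t z - biasedSteinDeriv c i j R t
  have hcoupled : ∀ t, ∑ S ∈ (univ : Finset (Fin N)).powersetCard (m + 2),
        steinDeriv t (∑ k ∈ S, c k) -
          κ * ∑ R ∈ s.powersetCard (m + 1), biasedSteinDeriv c i j R t =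
      ∑ R ∈ s.powersetCard (m + 1), (δ R (∑ k ∈ R, c k + c i) t + δ R (∑ k ∈ R, c k + c j) t +
        x * ∑ k ∈ s \ R, δ R (∑ k ∈ R, c k + c k) t +
        y * ∑ k ∈ R, δ R (∑ k ∈ R, c k - c k + c i + c j) t) := by
    -- `κ` is the total weight of the terms by which `sum_samples_eq` replaces each `R`.
    intro t
    rw [sum_samples_eq c (steinDeriv t) hij (by omega), mul_sum, ← sum_sub_distrib]
    refine sum_congr rfl fun R hR => ?_
    have hR1 := (mem_powersetCard.1 hR).1
    have hR2 := (mem_powersetCard.1 hR).2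
    have hc : ((s \ R).card : ℝ) = N - 2 - (m + 1) := by
      rw [card_sdiff_of_subset hR1, Nat.cast_sub (card_le_card hR1), hscard, hR2]
      push_cast
      ring
    simp only [δ, sum_sub_distrib, sum_const, nsmul_eq_mul, hc, hR2]
    rw [hκ]
    push_cast
    ring
  let h : Fin N → ℝ := fun k => |c k - c i| + |c k - c j|
  have hbound : L1NormLE (fun t => ∑ R ∈ s.powersetCard (m + 1),
      (δ R (∑ k ∈ R, c k + c i) t + δ R (∑ k ∈ R, c k + c j) t +
        x * ∑ k ∈ s \ R, δ R (∑ k ∈ R, c k + c k) t +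
        y * ∑ k ∈ R, δ R (∑ k ∈ R, c k - c k + c i + c j) t))
      (∑ R ∈ s.powersetCard (m + 1), (|c i - c j| + |c i - c j| + x * ∑ k ∈ s \ R, h k +
        y * ∑ k ∈ R, h k)) := by
    refine L1NormLE.sum _ fun R _ => ?_
    have hδ := l1NormLE_steinDeriv_sub_biasedSteinDeriv c i j R
    refine (((hδ _).mono (le_of_eq ?_)).add ((hδ _).mono (le_of_eq ?_))).add
      ((L1NormLE.sum _ fun k _ => (hδ _).mono (le_of_eq ?_)).const_mul hx0) |>.add
      ((L1NormLE.sum _ fun k _ => (hδ _).mono (le_of_eq ?_)).const_mul hy0)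
    · rw [sub_self, abs_zero, zero_add]
      congr 1
      ring
    · rw [sub_self, abs_zero, add_zero, abs_sub_comm]
      congr 1
      ring
    · simp only [h]
      congr 2 <;> ring
    · simp only [h]
      rw [add_comm, abs_sub_comm (c k) (c i), abs_sub_comm (c k) (c j)]
      congr 2 <;> ring
  simp only [hcoupled]
  refine hbound.mono ?_
  have h1 := card_mul_sum_powersetCard_sum s (m + 1) h
  have h2 := card_mul_sum_powersetCard_sum_sdiff s (m + 1) h
  rw [hscard, hscard'] at h1 h2
  push_cast at h1 h2
  have hN2 : (N : ℝ) - 2 ≠ 0 := by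
    have := Nat.cast_nonneg (α := ℝ) m
    linarith
  replace h1 := eq_div_of_mul_eq hN2 ((mul_comm _ _).trans h1)
  replace h2 := eq_div_of_mul_eq hN2 ((mul_comm _ _).trans h2)
  have hsub : ∑ k ∈ s, h k ≤ ∑ k, h k :=
    sum_le_sum_of_subset_of_nonneg (subset_univ _) fun k _ _ => by positivity
  have hκ2 : 0 ≤ κ - 2 := by
    rw [hκ]
    have := mul_nonneg hx0 (show 0 ≤ (N : ℝ) - 2 - ((m : ℝ) + 2 - 1) by linarith)
    have := mul_nonneg hy0 (show 0 ≤ (m : ℝ) + 2 - 1 by linarith [Nat.cast_nonneg (α := ℝ) m])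
    linarith
  have hcoef : 0 ≤ ((N - 2).choose (m + 1) : ℝ) * ((κ - 2) / (N - 2)) :=
    mul_nonneg (Nat.cast_nonneg _)
      (div_nonneg hκ2 (by linarith [Nat.cast_nonneg (α := ℝ) m]))
  have hfin := mul_le_mul_of_nonneg_left hsub hcoef
  refine le_trans (le_of_eq ?_) (add_le_add_right hfin
    (((N - 2).choose (m + 1) : ℝ) * (2 * |c i - c j|))) |>.trans (le_of_eq ?_)
  · simp only [sum_add_distrib, ← mul_sum, sum_const, nsmul_eq_mul, card_powersetCard]
    rw [h1, h2, hscard', hκ]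
    field_simp
    ring
  · simp only [h]
    ring

/-- The `L¹` distance to the normal for the sum of a uniformly distributed `(m + 2)`-subset of a
centred population, scaled so that this sum has variance one. -/
lemma l1NormLE_sample_cdf_sub (c : Fin N → ℝ) (hc : ∑ k, c k = 0) {m : ℕ} (hm : m + 3 < N)
    (hV : ∑ k, c k ^ 2 = sampleRatio ((m : ℝ) + 2) N) :
    L1NormLE (fun t =>
        (∑ S ∈ (univ : Finset (Fin N)).powersetCard (m + 2),
          if ∑ k ∈ S, c k ≤ t then (1 : ℝ) else 0) / N.choose (m + 2) - stdCdf t)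
      (4 * (∑ k, |c k| ^ 3) / sampleRatio ((m : ℝ) + 2) N * (1 + ((m : ℝ) + 2) / N) ^ 2) := by
  have hN : (m : ℝ) + 3 < N := by exact_mod_cast hm
  have hm0 := Nat.cast_nonneg (α := ℝ) m
  have hx : (m : ℝ) + 2 ≠ 0 := by positivity
  have hy : (N : ℝ) - (m + 2) ≠ 0 := by linarith
  have hN2 : 0 < (N : ℝ) - 2 := by linarith
  have hN0 : 0 < (N : ℝ) := by linarith
  have hκ := sampleRatio_eq hx hy
  have hchoose := choose_eq_sampleRatio_mul (show m + 2 < N by omega)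
  have hP : 0 < ((N - 2).choose (m + 1) : ℝ) := by
    exact_mod_cast Nat.choose_pos (by omega)
  have hκ2 : 2 ≤ sampleRatio ((m : ℝ) + 2) N := by
    rw [hκ]
    have := mul_nonneg (show 0 ≤ 1 / ((m : ℝ) + 2) by positivity)
      (show 0 ≤ (N : ℝ) - 2 - ((m : ℝ) + 2 - 1) by linarith)
    have := mul_nonneg (show 0 ≤ 1 / ((N : ℝ) - (m + 2)) from div_nonneg one_pos.le (by linarith))
      (show 0 ≤ (m : ℝ) + 2 - 1 by linarith)
    linarith
  clear hκ
  set κ := sampleRatio ((m : ℝ) + 2) N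
  set P := ((N - 2).choose (m + 1) : ℝ)
  set A3 := ∑ k, |c k| ^ 3
  have hA3 : 0 ≤ A3 := sum_nonneg fun k _ => by positivity
  have hNκ : 0 < 2 * N * κ := by positivity
  -- The weighted sum over the exchanged labels represents the difference of the distributions.
  have hrep : ∀ t, (∑ S ∈ (univ : Finset (Fin N)).powersetCard (m + 2),
          if ∑ k ∈ S, c k ≤ t then (1 : ℝ) else 0) / N.choose (m + 2) - stdCdf t =
      (1 / (2 * N * κ * (κ * P))) * ∑ i, ∑ j, (c i - c j) ^ 2 *
        (∑ S ∈ (univ : Finset (Fin N)).powersetCard (m + 2), steinDeriv t (∑ k ∈ S, c k) -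
          κ * ∑ R ∈ (univ \ {i, j} : Finset (Fin N)).powersetCard (m + 1),
            biasedSteinDeriv c i j R t) := by
    intro t
    have h1 : ∑ S ∈ (univ : Finset (Fin N)).powersetCard (m + 2),
          (steinDeriv t (∑ k ∈ S, c k) - (∑ k ∈ S, c k) * steinSol t (∑ k ∈ S, c k)) =
        (∑ S ∈ (univ : Finset (Fin N)).powersetCard (m + 2),
          if ∑ k ∈ S, c k ≤ t then (1 : ℝ) else 0) - κ * P * stdCdf t := by
      simp only [steinDeriv_sub_mul_steinSol, sum_sub_distrib, sum_const, card_powersetCard,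
        card_univ, Fintype.card_fin, nsmul_eq_mul, hchoose]
    have h2 : 2 * N * ∑ S ∈ (univ : Finset (Fin N)).powersetCard (m + 2),
          (∑ k ∈ S, c k) * steinSol t (∑ k ∈ S, c k) =
        ∑ i, ∑ j, (c i - c j) ^ 2 *
          ∑ R ∈ (univ \ {i, j} : Finset (Fin N)).powersetCard (m + 1),
            biasedSteinDeriv c i j R t := by
      rw [sum_samples_mul_eq c hc (steinSol t) (m + 1)]
      refine sum_congr rfl fun i _ => sum_congr rfl fun j _ => ?_
      rw [sq, mul_assoc]
      congr 1
      rw [mul_sum]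
      refine sum_congr rfl fun R _ => ?_
      rw [steinSol_sub_steinSol, biasedSteinDeriv]
      congr 1
      ring
    have h3 : ∑ i, ∑ j, (c i - c j) ^ 2 = 2 * N * κ := by
      rw [sum_sum_sub_sq c hc, Fintype.card_fin, hV]
    have h4 : ∑ i, ∑ j, (c i - c j) ^ 2 *
        (∑ S ∈ (univ : Finset (Fin N)).powersetCard (m + 2), steinDeriv t (∑ k ∈ S, c k) -
          κ * ∑ R ∈ (univ \ {i, j} : Finset (Fin N)).powersetCard (m + 1),
            biasedSteinDeriv c i j R t) =
        2 * N * κ * ∑ S ∈ (univ : Finset (Fin N)).powersetCard (m + 2),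
          (steinDeriv t (∑ k ∈ S, c k) - (∑ k ∈ S, c k) * steinSol t (∑ k ∈ S, c k)) := by
      simp only [mul_sub, sum_sub_distrib, ← sum_mul, mul_left_comm _ κ, ← mul_sum, h3, ← h2]
      ring
    rw [h4, h1, hchoose]
    have : κ ≠ 0 := by linarith
    field_simp
  simp only [hrep]
  have hsum : L1NormLE (fun t => ∑ i, ∑ j, (c i - c j) ^ 2 *
        (∑ S ∈ (univ : Finset (Fin N)).powersetCard (m + 2), steinDeriv t (∑ k ∈ S, c k) -
          κ * ∑ R ∈ (univ \ {i, j} : Finset (Fin N)).powersetCard (m + 1),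
            biasedSteinDeriv c i j R t))
      (∑ i, ∑ j, (c i - c j) ^ 2 * (P * (2 * |c i - c j| +
        (κ - 2) / (N - 2) * ∑ k, (|c k - c i| + |c k - c j|)))) := by
    refine L1NormLE.sum _ fun i _ => L1NormLE.sum _ fun j _ => ?_
    by_cases hij : i = j
    · subst hij
      simp only [sub_self, ne_eq, OfNat.ofNat_ne_zero, not_false_eq_true, zero_pow, zero_mul]
      exact ⟨by simp, by simp⟩
    · exact (l1NormLE_sum_steinDeriv_sub c hij hm).const_mul (sq_nonneg _)
  refine (hsum.const_mul (by positivity)).mono ?_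
  have hT1 := sum_sum_sub_sq_mul_abs_le c hc
  have hT2 := sum_sum_sum_sub_sq_mul_abs_le c hc
  rw [Fintype.card_fin] at hT1 hT2
  have hT3 : ∑ i, ∑ j, ∑ k, (c i - c j) ^ 2 * |c k - c j| =
      ∑ i, ∑ j, ∑ k, (c i - c j) ^ 2 * |c k - c i| := by
    rw [sum_comm]
    refine sum_congr rfl fun i _ => sum_congr rfl fun j _ => sum_congr rfl fun k _ => ?_
    ring
  have hexpand : ∑ i, ∑ j, (c i - c j) ^ 2 * (P * (2 * |c i - c j| +
        (κ - 2) / (N - 2) * ∑ k, (|c k - c i| + |c k - c j|))) =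
      P * (2 * ∑ i, ∑ j, (c i - c j) ^ 2 * |c i - c j| +
        (κ - 2) / (N - 2) * (2 * ∑ i, ∑ j, ∑ k, (c i - c j) ^ 2 * |c k - c i|)) := by
    have hterm : ∀ i j, (c i - c j) ^ 2 * (P * (2 * |c i - c j| +
        (κ - 2) / (N - 2) * ∑ k, (|c k - c i| + |c k - c j|))) =
        P * 2 * ((c i - c j) ^ 2 * |c i - c j|) +
          P * ((κ - 2) / (N - 2)) * (∑ k, (c i - c j) ^ 2 * |c k - c i|) +
          P * ((κ - 2) / (N - 2)) * (∑ k, (c i - c j) ^ 2 * |c k - c j|) := fun i j => by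
      rw [sum_add_distrib, ← mul_sum, ← mul_sum]
      ring
    have hlin : ∀ (x y : ℝ) (f g h : Fin N → Fin N → ℝ),
        ∑ i, ∑ j, (x * f i j + y * g i j + y * h i j) =
          x * (∑ i, ∑ j, f i j) + y * (∑ i, ∑ j, g i j) + y * ∑ i, ∑ j, h i j :=
      fun x y f g h => by simp only [sum_add_distrib, mul_sum]
    simp only [hterm]
    rw [hlin, hT3]
    ring
  rw [hexpand]
  have hq : 0 ≤ (κ - 2) / ((N : ℝ) - 2) := div_nonneg (by linarith) hN2.le
  have hmain : P * (2 * ∑ i, ∑ j, (c i - c j) ^ 2 * |c i - c j| +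
        (κ - 2) / (N - 2) * (2 * ∑ i, ∑ j, ∑ k, (c i - c j) ^ 2 * |c k - c i|)) ≤
      P * (2 * (4 * N * A3) + (κ - 2) / (N - 2) * (2 * (4 * (N : ℝ) ^ 2 * A3))) := by
    gcongr
  -- It suffices that `κ / (N - 2) ≤ κ n / N`, that is, `N ≤ n (N - 2)`.
  have hnum : 1 + (κ - 2) / (N - 2) * N ≤ κ * (1 + ((m : ℝ) + 2) / N) ^ 2 := by
    have h1 : (κ - 2) / (N - 2) * N = (κ - 2) + 2 * ((κ - 2) / (N - 2)) := by
      field_simp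
      ring
    have h2 : (κ - 2) / ((N : ℝ) - 2) ≤ κ * (((m : ℝ) + 2) / N) := by
      rw [div_le_iff₀ hN2, mul_assoc]
      have h3 : 1 ≤ ((m : ℝ) + 2) / N * (N - 2) := by
        rw [div_mul_eq_mul_div, le_div_iff₀ hN0]
        rcases Nat.eq_zero_or_pos m with rfl | hmpos
        · have : (4 : ℝ) ≤ N := by exact_mod_cast hm
          push_cast
          linarith
        · have : (1 : ℝ) ≤ m := by exact_mod_cast hmpos
          nlinarith
      nlinarith
    have h3 : 0 ≤ κ * (((m : ℝ) + 2) / N) ^ 2 := by positivity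
    nlinarith
  calc _ ≤ 1 / (2 * N * κ * (κ * P)) *
        (P * (2 * (4 * N * A3) + (κ - 2) / (N - 2) * (2 * (4 * (N : ℝ) ^ 2 * A3)))) :=
        mul_le_mul_of_nonneg_left hmain (by positivity)
    _ = 4 * A3 / κ ^ 2 * (1 + (κ - 2) / (N - 2) * N) := by
        have : κ ≠ 0 := by linarith
        field_simp
    _ ≤ 4 * A3 / κ ^ 2 * (κ * (1 + ((m : ℝ) + 2) / N) ^ 2) :=
        mul_le_mul_of_nonneg_left hnum (by positivity)
    _ = _ := by
        have : κ ≠ 0 := by linarith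
        field_simp

end Bound

/-! ### Simple random samples -/

section Law

variable {Ω : Type*} [MeasurableSpace Ω] {P : Measure Ω} {n N : ℕ}
  {a : Fin N → ℝ} {X : Fin n → Ω → ℝ}

lemma measurableSet_sample_eq (hX : ∀ i, Measurable (X i)) (M : Multiset ℝ) :
    MeasurableSet {ω | (univ : Finset (Fin n)).val.map (fun i => X i ω) = M} := by
  have hfin : {x : Fin n → ℝ | (univ : Finset (Fin n)).val.map x = M}.Finite := by
    refine (Fintype.piFinset fun _ : Fin n => M.toFinset).finite_toSet.subset fun x hx => ?_
    rw [mem_coe, Fintype.mem_piFinset]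
    intro i
    have hx' : (univ : Finset (Fin n)).val.map x = M := hx
    rw [← hx', Multiset.mem_toFinset]
    exact Multiset.mem_map_of_mem x (mem_univ i)
  exact (measurable_pi_lambda (fun ω i => X i ω) hX) hfin.measurableSet

lemma IsSimpleRandomSample.law_eq_card_filter (hX : IsSimpleRandomSample P a X) (M : Multiset ℝ) :
    P.real {ω | (univ : Finset (Fin n)).val.map (fun i => X i ω) = M} =
      (((univ : Finset (Fin N)).powersetCard n).filter fun s => s.val.map a = M).card /
        (N.choose n : ℝ) := by
  rw [hX.law, Nat.subtype_card]
  intro s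
  simp [mem_powersetCard]

/-- A statistic of a simple random sample which does not depend on the order is integrable, and
its expectation is the average of its values over all subsets of `n` labels. -/
lemma IsSimpleRandomSample.integral_eq [IsProbabilityMeasure P]
    (hX : IsSimpleRandomSample P a X) (hnN : n ≤ N)
    (g : Multiset ℝ → ℝ) :
    Integrable (fun ω => g ((univ : Finset (Fin n)).val.map fun i => X i ω)) P ∧
      ∫ ω, g ((univ : Finset (Fin n)).val.map fun i => X i ω) ∂P =
        (∑ S ∈ (univ : Finset (Fin N)).powersetCard n, g (S.val.map a)) / N.choose n := by
  classical
  have hC : (N.choose n : ℝ) ≠ 0 := by exact_mod_cast (Nat.choose_pos hnN).ne'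
  set T : Finset (Multiset ℝ) :=
    ((univ : Finset (Fin N)).powersetCard n).image fun S => S.val.map a with hT
  let E : Multiset ℝ → Set Ω := fun M =>
    {ω | (univ : Finset (Fin n)).val.map (fun i => X i ω) = M}
  have hE : ∀ M, MeasurableSet (E M) := measurableSet_sample_eq hX.measurable
  have hfib : ∀ h : Multiset ℝ → ℝ, ∑ M ∈ T, P.real (E M) * h M =
      (∑ S ∈ (univ : Finset (Fin N)).powersetCard n, h (S.val.map a)) / N.choose n := by
    intro h
    rw [sum_div, ← sum_fiberwise_of_maps_to (g := fun S : Finset (Fin N) => S.val.map a) (t := T)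
      fun S hS => mem_image_of_mem _ hS]
    refine sum_congr rfl fun M _ => ?_
    rw [hX.law_eq_card_filter, sum_congr rfl fun S hS => by rw [(mem_filter.1 hS).2], sum_const,
      nsmul_eq_mul]
    ring
  have hae : ∀ᵐ ω ∂P, (univ : Finset (Fin n)).val.map (fun i => X i ω) ∈ T := by
    have h1 : P.real (⋃ M ∈ T, E M) = 1 := by
      rw [measureReal_biUnion_finset (fun M _ M' _ hne => ?_) fun M _ => hE M]
      · have := hfib fun _ => 1
        simp only [mul_one, sum_const, card_powersetCard, card_univ, Fintype.card_fin,
          nsmul_eq_mul] at this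
        rw [this, div_self hC]
      · exact Set.disjoint_left.2 fun ω hω hω' => hne (Eq.trans (Eq.symm hω) hω')
    have h2 : P (⋃ M ∈ T, E M) = 1 := by
      rw [measureReal_def] at h1
      rw [← ENNReal.ofReal_toReal (measure_ne_top P _), h1, ENNReal.ofReal_one]
    have h3 := (prob_compl_eq_zero_iff (Finset.measurableSet_biUnion T fun M _ => hE M)).2 h2
    filter_upwards [mem_ae_iff.2 (by rwa [compl_compl] : P ((⋃ M ∈ T, E M)ᶜᶜ)ᶜ = 0)] with ω hω
    rw [compl_compl] at hω
    obtain ⟨M, hM, hω'⟩ := Set.mem_iUnion₂.1 hω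
    have hω'' : (univ : Finset (Fin n)).val.map (fun i => X i ω) = M := hω'
    rwa [hω'']
  have heq : (fun ω => ∑ M ∈ T, (E M).indicator (fun _ => g M) ω) =ᵐ[P]
      fun ω => g ((univ : Finset (Fin n)).val.map fun i => X i ω) := by
    filter_upwards [hae] with ω hω
    rw [sum_eq_single_of_mem _ hω fun M _ hne => Set.indicator_of_notMem (fun h => hne ?_) _]
    · exact Set.indicator_of_mem (Eq.refl _) _
    · exact (Eq.symm h)
  have hint : ∀ M ∈ T, Integrable ((E M).indicator fun _ => g M) P := fun M _ =>
    (integrable_const (g M)).indicator (hE M)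
  refine ⟨(integrable_finsetSum T hint).congr heq, ?_⟩
  rw [← integral_congr_ae heq, integral_finsetSum T hint, ← hfib g]
  refine sum_congr rfl fun M _ => ?_
  rw [integral_indicator (hE M), setIntegral_const, smul_eq_mul]

end Law

section Population

variable {N : ℕ}

lemma sum_sub_popMean (hN : N ≠ 0) (a : Fin N → ℝ) : ∑ k, (a k - popMean a) = 0 := by
  have : (N : ℝ) ≠ 0 := by exact_mod_cast hN
  rw [sum_sub_distrib, sum_const, card_univ, Fintype.card_fin, nsmul_eq_mul, popMean]
  field_simp
  ring

lemma sum_sample_eq {n : ℕ} (a : Fin N → ℝ) {S : Finset (Fin N)}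
    (hS : S ∈ (univ : Finset (Fin N)).powersetCard n) :
    (S.val.map a).sum - sumMean n a = ∑ k ∈ S, (a k - popMean a) := by
  rw [sum_sub_distrib, sum_const, (mem_powersetCard.1 hS).2, nsmul_eq_mul, sumMean]
  rfl

lemma sumVariance_eq {m : ℕ} (a : Fin N → ℝ) :
    sumVariance (m + 2) a =
      (∑ k, (a k - popMean a) ^ 2) / sampleRatio ((m : ℝ) + 2) N := by
  rw [sumVariance, sampleRatio, div_div_eq_mul_div]
  push_cast
  ring

/-- The variance of a sample sum is the case `f = id` of the exchange identity. -/
lemma sum_samples_sq (c : Fin N → ℝ) (hc : ∑ k, c k = 0) {m : ℕ} (hm : m + 2 < N) :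
    (∑ S ∈ (univ : Finset (Fin N)).powersetCard (m + 2), (∑ k ∈ S, c k) ^ 2) / N.choose (m + 2) =
      (∑ k, c k ^ 2) / sampleRatio ((m : ℝ) + 2) N := by
  have h := sum_samples_mul_eq c hc id (m + 1)
  have hterm : ∀ i j, (c i - c j) * ∑ R ∈ (univ \ {i, j} : Finset (Fin N)).powersetCard (m + 1),
        (∑ k ∈ R, c k + c i - (∑ k ∈ R, c k + c j)) =
      ((N - 2).choose (m + 1) : ℝ) * (c i - c j) ^ 2 := fun i j => by
    by_cases hij : i = j
    · simp [hij]
    · simp only [add_sub_add_left_eq_sub, sum_const, card_powersetCard,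
        card_univ_sdiff_pair hij, nsmul_eq_mul]
      ring
  simp only [id, hterm, ← mul_sum, sum_sum_sub_sq c hc, Fintype.card_fin] at h
  have hN : (N : ℝ) ≠ 0 := by
    have : N ≠ 0 := by omega
    exact_mod_cast this
  have hP : ((N - 2).choose (m + 1) : ℝ) ≠ 0 := by
    have := (Nat.choose_pos (show m + 1 ≤ N - 2 by omega)).ne'
    exact_mod_cast this
  have h2 : ∑ S ∈ (univ : Finset (Fin N)).powersetCard (m + 2), (∑ k ∈ S, c k) ^ 2 =
      ((N - 2).choose (m + 1) : ℝ) * ∑ k, c k ^ 2 := by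
    refine mul_left_cancel₀ (mul_ne_zero two_ne_zero hN) ?_
    simp only [sq] at h ⊢
    linarith
  rw [h2, choose_eq_sampleRatio_mul hm, mul_comm (sampleRatio _ _), mul_div_mul_left _ _ hP]

end Population

end SimpleRandomSampling

open SimpleRandomSampling in
theorem theorem5p1 {Ω : Type*} [MeasurableSpace Ω] (P : Measure Ω) [IsProbabilityMeasure P]
    (n N : ℕ) (hn : 2 < n) (hnN : n + 1 < N)
    (a : Fin N → ℝ) (ha : ∃ j k, a j ≠ a k)
    (X : Fin n → Ω → ℝ) (hX : SimpleRandomSampling.IsSimpleRandomSample P a X) :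
    (∫ ω, ∑ i, X i ω ∂P) = SimpleRandomSampling.sumMean n a ∧
    variance (fun ω => ∑ i, X i ω) P = SimpleRandomSampling.sumVariance n a ∧
    Integrable (fun t : ℝ =>
      cdf (P.map (SimpleRandomSampling.standardizedSum a X)) t - cdf (gaussianReal 0 1) t) ∧
    (∫ t : ℝ,
      |cdf (P.map (SimpleRandomSampling.standardizedSum a X)) t - cdf (gaussianReal 0 1) t|) ≤
      4 * SimpleRandomSampling.popThird a / SimpleRandomSampling.sumStdDev n a ^ 3 *
        ((n * ((N : ℝ) - n)) / (N * ((N : ℝ) - 1))) * (1 + (n : ℝ) / N) ^ 2 := by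
  obtain ⟨m, rfl⟩ : ∃ m, n = m + 2 := ⟨n - 2, by omega⟩
  have hN0 : N ≠ 0 := by omega
  have hNR : (N : ℝ) ≠ 0 := by exact_mod_cast hN0
  have hle : m + 2 ≤ N := by omega
  have hC : (N.choose (m + 2) : ℝ) ≠ 0 := by exact_mod_cast (Nat.choose_pos hle).ne'
  have hmeas : Measurable fun ω => ∑ i, X i ω := Finset.measurable_sum _ fun i _ => hX.measurable i
  have hY : ∀ ω, ∑ i, X i ω = ((Finset.univ : Finset (Fin (m + 2))).val.map fun i => X i ω).sum :=
    fun ω => rfl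
  set b : Fin N → ℝ := fun k => a k - popMean a with hb
  have hb0 : ∑ k, b k = 0 := sum_sub_popMean hN0 a
  have hmean : (∫ ω, ∑ i, X i ω ∂P) = sumMean (m + 2) a := by
    have h := (hX.integral_eq hle fun M => M.sum - sumMean (m + 2) a)
    have hi := (hX.integral_eq hle fun M => M.sum).1
    have h0 := card_mul_sum_powersetCard_sum (Finset.univ : Finset (Fin N)) (m + 2) b
    rw [hb0, mul_zero, Finset.card_univ, Fintype.card_fin] at h0
    have h2 := h.2
    rw [Finset.sum_congr rfl fun S hS => sum_sample_eq a hS, (mul_eq_zero.1 h0).resolve_left hNR,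
      zero_div, integral_sub hi (integrable_const _)] at h2
    simp only [integral_const, probReal_univ, one_smul, ← hY] at h2
    linarith
  refine ⟨hmean, ?_, ?_⟩
  · rw [variance_eq_integral hmeas.aemeasurable, hmean, sumVariance_eq,
      ← sum_samples_sq b hb0 (by omega)]
    have h := (hX.integral_eq hle fun M => (M.sum - sumMean (m + 2) a) ^ 2).2
    rw [Finset.sum_congr rfl fun S hS => by rw [sum_sample_eq a hS]] at h
    exact h
  · have hκ : 0 < sampleRatio ((m : ℝ) + 2) N := by
      have h1 : (m : ℝ) + 3 < N := by exact_mod_cast hnN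
      have h0 := Nat.cast_nonneg (α := ℝ) m
      exact div_pos (mul_pos (by linarith) (by linarith)) (mul_pos (by linarith) (by linarith))
    have hB : 0 < ∑ k, b k ^ 2 := by
      refine (Finset.sum_nonneg fun k _ => sq_nonneg (b k)).lt_of_ne' fun h => ?_
      have hz : ∀ k, a k = popMean a := fun k => by
        have := (Finset.sum_eq_zero_iff_of_nonneg fun k _ => sq_nonneg (b k)).1 h k
          (Finset.mem_univ k)
        exact sub_eq_zero.1 (pow_eq_zero_iff two_ne_zero |>.1 this)
      obtain ⟨j, k, hjk⟩ := ha
      exact hjk ((hz j).trans (hz k).symm)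
    have hvar : 0 < sumVariance (m + 2) a := by
      rw [sumVariance_eq]
      exact div_pos hB hκ
    set σ := sumStdDev (m + 2) a with hσdef
    have hσ : 0 < σ := Real.sqrt_pos.2 hvar
    have hσ2 : σ ^ 2 = (∑ k, b k ^ 2) / sampleRatio ((m : ℝ) + 2) N := by
      rw [hσdef, sumStdDev, Real.sq_sqrt hvar.le, sumVariance_eq]
    let c : Fin N → ℝ := fun k => b k / σ
    have hc0 : ∑ k, c k = 0 := by
      rw [← Finset.sum_div, hb0, zero_div]
    have hcV : ∑ k, c k ^ 2 = sampleRatio ((m : ℝ) + 2) N := by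
      simp only [c, div_pow, ← Finset.sum_div, hσ2]
      field_simp
    have hWmeas : Measurable (standardizedSum a X) := (hmeas.sub_const _).div_const _
    have : IsProbabilityMeasure (P.map (standardizedSum a X)) :=
      Measure.isProbabilityMeasure_map hWmeas.aemeasurable
    have hcdf : ∀ t, cdf (P.map (standardizedSum a X)) t =
        (∑ S ∈ (Finset.univ : Finset (Fin N)).powersetCard (m + 2),
          if ∑ k ∈ S, c k ≤ t then (1 : ℝ) else 0) / N.choose (m + 2) := by
      intro t
      have hset : MeasurableSet (standardizedSum a X ⁻¹' Set.Iic t) := hWmeas measurableSet_Iic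
      have h := (hX.integral_eq hle fun M =>
        if (M.sum - sumMean (m + 2) a) / σ ≤ t then (1 : ℝ) else 0).2
      rw [Finset.sum_congr rfl fun S hS => by rw [sum_sample_eq a hS, Finset.sum_div]] at h
      rw [cdf_eq_real, map_measureReal_apply hWmeas measurableSet_Iic, ← h,
        ← integral_indicator_one hset]
      refine integral_congr_ae (ae_of_all _ fun ω => ?_)
      rfl
    have hmain := l1NormLE_sample_cdf_sub c hc0 hnN hcV
    simp only [← hcdf] at hmain
    refine ⟨hmain.1, hmain.2.trans (le_of_eq ?_)⟩
    have hA : ∑ k, |c k| ^ 3 = popThird a / σ ^ 3 := by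
      simp only [c, abs_div, abs_of_pos hσ, div_pow, ← Finset.sum_div]
      rfl
    rw [hA, sampleRatio]
    push_cast
    rw [div_div_eq_mul_div]
    ring
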